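/- Conventions. Modules are left modules; right modules over a ring $\Gamma$ are $\Gamma^{op}$-modules. A noetherian algebra is a ring $\Gamma$ that is an algebra over a commutative noetherian ring $R$ and finitely generated as an $R$-module. For a $\Gamma$-module (or $\Gamma^{op}$-module) $L$, the group $\mathrm{Ext}^i(L,\Gamma)$ is a $\Gamma^{op}$-module (respectively $\Gamma$-module). Put $\mathrm{grade}\,L=\inf\{i\ge 0 : \mathrm{Ext}^i(L,\Gamma)\ne 0\}$, $\mathrm{r.grade}\,L=\inf\{i>0 : \mathrm{Ext}^i(L,\Gamma)\ne 0\}$ (reduced grade) and $\mathrm{s.grade}\,L=\inf\{\mathrm{grade}\,M : M\subseteq L\}$ (strong grade), with $\inf\emptyset=\infty$. The ring $\Gamma$ satisfies the $(l,m)$-condition if $\mathrm{s.grade}\,\mathrm{Ext}^l(L,\Gamma)\ge m$ for every finitely generated $\Gamma^{op}$-module $L$, and the $(l,m)^{op}$-condition if $\Gamma^{op}$ satisfies the $(l,m)$-condition. Put $F_n:=\mathrm{soc}\,\mathrm{Ext}^n(-,\Gamma)$, on $\Gamma$-modules and on $\Gamma^{op}$-modules. **Theorem.** Let $n\ge 0$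 and let $\Gamma$ be a noetherian algebra satisfying the $(l,l)$- and $(l,l)^{op}$-conditions for $l=n$ and $l=n+1$ (for $l=0$ these conditions are vacuous). (1) $\Gamma$ satisfies the condition $(D_n)$: the assignment $L\mapsto F_nL$ gives a bijection from the isomorphism classes of simple $\Gamma$-modules of grade $n$ to the isomorphism classes of simple $\Gamma^{op}$-modules of grade $n$; moreover, for every simple $\Gamma$-module $L$ of grade $n$, $F_nF_nL\cong L$ and $\mathrm{s.grade}\bigl(\mathrm{Ext}^n(L,\Gamma)/F_nL\bigr)>n$. (2) If in addition $\mathrm{gl.dim}\,\Gamma=n\ge 2$, then for every simple $\Gamma$-module $L$ with $\mathrm{grade}\,L=0$ and $\mathrm{r.grade}\,L=n-1$, the $\Gamma^{op}$-module $F_{n-1}L$ is simple and $\mathrm{s.grade}\,\mathrm{Ext}^{n-1}(L,\Gamma)=n$. -/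

import Mathlib

open CategoryTheory

universe u

/-!  Throughout, `A` and `B` are rings and `W` is a module over `A` and over `B` whose two actions
commute (a bimodule).  For a ring `Γ` and `W = Γ` there are two cases of interest:

* `A = Γ`, `B = Γᵐᵒᵖ`: left `Γ`-modules `L`, with `Ext^n_Γ(L, Γ)` a right `Γ`-module;
* `A = Γᵐᵒᵖ`, `B = Γ`: right `Γ`-modules `L`, with `Ext^n_{Γᵐᵒᵖ}(L, Γ)` a left `Γ`-module. -/

noncomputable section

/-- The group `Ext^n_A(L, W)`. -/
def ExtMod (A W L : Type u) [Ring A] [AddCommGroup W] [Module A W] [AddCommGroup L] [Module A L]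
    (n : ℕ) : Type u :=
  Abelian.Ext (ModuleCat.of A L) (ModuleCat.of A W) n

instance ExtMod.instAddCommGroup (A W L : Type u) [Ring A] [AddCommGroup W] [Module A W]
    [AddCommGroup L] [Module A L] (n : ℕ) : AddCommGroup (ExtMod A W L n) :=
  inferInstanceAs (AddCommGroup (Abelian.Ext (ModuleCat.of A L) (ModuleCat.of A W) n))

/-- The `A`-linear endomorphism `w ↦ b • w` of `W`, as a morphism of `A`-modules. -/
def actionHom (A W : Type u) {B : Type u} [Ring A] [Ring B] [AddCommGroup W] [Module A W]
    [Module B W] [SMulCommClass B A W] (b : B) : ModuleCat.of A W ⟶ ModuleCat.of A W :=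
  ModuleCat.ofHom (Module.toModuleEnd A W b)

/-- The `B`-module structure on `Ext^n_A(L, W)` induced by the action of `B` on `W`:
`b • x` is the image of `x` under `Ext^n_A(L, w ↦ b • w)`. -/
instance ExtMod.instModule (A W L B : Type u) [Ring A] [Ring B] [AddCommGroup W] [Module A W]
    [Module B W] [SMulCommClass B A W] [AddCommGroup L] [Module A L] (n : ℕ) :
    Module B (ExtMod A W L n) where
  smul b x := Abelian.Ext.comp (C := ModuleCat.{u} A) x (Abelian.Ext.mk₀ (actionHom A W b))
    (add_zero n)
  one_smul x := by
    have h : actionHom A W (1 : B) = 𝟙 _ := by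
      ext w; simp [actionHom]
    change Abelian.Ext.comp (C := ModuleCat.{u} A) x _ _ = x
    rw [h]; exact Abelian.Ext.comp_mk₀_id _
  mul_smul b c x := by
    have h : actionHom A W (b * c) = actionHom A W c ≫ actionHom A W b := by
      ext w; simp [actionHom, mul_smul]
    change Abelian.Ext.comp (C := ModuleCat.{u} A) x _ _ =
      Abelian.Ext.comp (C := ModuleCat.{u} A) (Abelian.Ext.comp (C := ModuleCat.{u} A) x _ _) _ _
    rw [h, ← Abelian.Ext.mk₀_comp_mk₀]
    exact (Abelian.Ext.comp_assoc_of_third_deg_zero (C := ModuleCat.{u} A) _ _ _ _).symm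
  smul_zero b := Abelian.Ext.zero_comp (C := ModuleCat.{u} A) _ n _ n (add_zero n)
  smul_add b x y := Abelian.Ext.add_comp (C := ModuleCat.{u} A) _ _ _ _
  add_smul b c x := by
    have h : actionHom A W (b + c) = actionHom A W b + actionHom A W c := by
      ext w; simp [actionHom, add_smul]
    change Abelian.Ext.comp (C := ModuleCat.{u} A) x _ _ = _
    rw [h, Abelian.Ext.mk₀_add]
    exact Abelian.Ext.comp_add (C := ModuleCat.{u} A) _ _ _ _
  zero_smul x := by
    have h : actionHom A W (0 : B) = 0 := by
      ext w; simp [actionHom]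
    change Abelian.Ext.comp (C := ModuleCat.{u} A) x _ _ = 0
    rw [h, Abelian.Ext.mk₀_zero]
    exact Abelian.Ext.comp_zero (C := ModuleCat.{u} A) _ _ _ _ _

/-- The grade `inf {i ≥ 0 | Ext^i_A(L, W) ≠ 0}` of `L` (with `inf ∅ = ∞`). -/
def moduleGrade (A W L : Type u) [Ring A] [AddCommGroup W] [Module A W] [AddCommGroup L]
    [Module A L] : ℕ∞ :=
  ⨅ (i : ℕ) (_ : Nontrivial (ExtMod A W L i)), (i : ℕ∞)

/-- The reduced grade `inf {i > 0 | Ext^i_A(L, W) ≠ 0}` of `L`. -/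
def reducedGrade (A W L : Type u) [Ring A] [AddCommGroup W] [Module A W] [AddCommGroup L]
    [Module A L] : ℕ∞ :=
  ⨅ (i : ℕ) (_ : 0 < i) (_ : Nontrivial (ExtMod A W L i)), (i : ℕ∞)

/-- The strong grade of `L`: the infimum of the grades of all submodules of `L`. -/
def strongGrade (A W L : Type u) [Ring A] [AddCommGroup W] [Module A W] [AddCommGroup L]
    [Module A L] : ℕ∞ :=
  ⨅ M : Submodule A L, moduleGrade A W M

/-- The socle of a module: the sum of its simple submodules. -/
def socle (A M : Type u) [Ring A] [AddCommGroup M] [Module A M] : Submodule A M :=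
  sSup {S : Submodule A M | IsSimpleModule A S}

/-- `soc Ext^n_A(L, W)`, a `B`-submodule of `Ext^n_A(L, W)`. -/
abbrev socExt (A B W L : Type u) [Ring A] [Ring B] [AddCommGroup W] [Module A W] [Module B W]
    [SMulCommClass B A W] [AddCommGroup L] [Module A L] (n : ℕ) :
    Submodule B (ExtMod A W L n) :=
  socle B (ExtMod A W L n)

/-- For every finitely generated `B`-module `L`, the `A`-module `Ext^l_B(L, W)` has strong grade
at least `n`. -/
def ExtStrongGradeCondition (A B W : Type u) [Ring A] [Ring B] [AddCommGroup W] [Module A W]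
    [Module B W] [SMulCommClass A B W] (l n : ℕ) : Prop :=
  ∀ (L : Type u) [AddCommGroup L] [Module B L] [Module.Finite B L],
    (n : ℕ∞) ≤ strongGrade A W (ExtMod B W L l)

/-- The `(l,n)`-condition on `Γ`: the left module `Ext^l(L, Γ)` has strong grade at least `n` for
every finitely generated right `Γ`-module `L`. -/
def LNCondition (Γ : Type u) [Ring Γ] (l n : ℕ) : Prop :=
  ExtStrongGradeCondition Γ Γᵐᵒᵖ Γ l n

/-- The `(l,n)^op`-condition on `Γ`: the right module `Ext^l(L, Γ)` has strong grade at least `n`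
for every finitely generated left `Γ`-module `L`. -/
def LNConditionOp (Γ : Type u) [Ring Γ] (l n : ℕ) : Prop :=
  ExtStrongGradeCondition Γᵐᵒᵖ Γ Γ l n

/-- `L` is a simple `A`-module of grade `n`. -/
def IsSimpleOfGrade (A W L : Type u) [Ring A] [AddCommGroup W] [Module A W] [AddCommGroup L]
    [Module A L] (n : ℕ) : Prop :=
  IsSimpleModule A L ∧ moduleGrade A W L = n

/-- The condition `(D_n)` on `Γ`, where `F_n = soc Ext^n(-, Γ)` (from left to right modules, and
from right to left modules). The first four fields say that `L ↦ F_n L` is a well-defined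
bijection from isomorphism classes of simple left `Γ`-modules of grade `n` to isomorphism classes
of simple right `Γ`-modules of grade `n`. -/
structure DualityCondition (Γ : Type u) [Ring Γ] (n : ℕ) : Prop where
  mapsTo : ∀ (L : Type u) [AddCommGroup L] [Module Γ L], IsSimpleOfGrade Γ Γ L n →
    IsSimpleOfGrade Γᵐᵒᵖ Γ (socExt Γ Γᵐᵒᵖ Γ L n) n
  congr : ∀ (L L' : Type u) [AddCommGroup L] [Module Γ L] [AddCommGroup L'] [Module Γ L'],
    IsSimpleOfGrade Γ Γ L n → IsSimpleOfGrade Γ Γ L' n → Nonempty (L ≃ₗ[Γ] L') →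
      Nonempty (socExt Γ Γᵐᵒᵖ Γ L n ≃ₗ[Γᵐᵒᵖ] socExt Γ Γᵐᵒᵖ Γ L' n)
  injective : ∀ (L L' : Type u) [AddCommGroup L] [Module Γ L] [AddCommGroup L'] [Module Γ L'],
    IsSimpleOfGrade Γ Γ L n → IsSimpleOfGrade Γ Γ L' n →
      Nonempty (socExt Γ Γᵐᵒᵖ Γ L n ≃ₗ[Γᵐᵒᵖ] socExt Γ Γᵐᵒᵖ Γ L' n) → Nonempty (L ≃ₗ[Γ] L')
  surjective : ∀ (N : Type u) [AddCommGroup N] [Module Γᵐᵒᵖ N], IsSimpleOfGrade Γᵐᵒᵖ Γ N n →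
    ∃ (L : Type u) (_ : AddCommGroup L) (_ : Module Γ L), IsSimpleOfGrade Γ Γ L n ∧
      Nonempty (socExt Γ Γᵐᵒᵖ Γ L n ≃ₗ[Γᵐᵒᵖ] N)
  involutive : ∀ (L : Type u) [AddCommGroup L] [Module Γ L], IsSimpleOfGrade Γ Γ L n →
    Nonempty (socExt Γᵐᵒᵖ Γ Γ (socExt Γ Γᵐᵒᵖ Γ L n) n ≃ₗ[Γ] L)
  quotient : ∀ (L : Type u) [AddCommGroup L] [Module Γ L], IsSimpleOfGrade Γ Γ L n →
    (n : ℕ∞) < strongGrade Γᵐᵒᵖ Γ (ExtMod Γ Γ L n ⧸ socExt Γ Γᵐᵒᵖ Γ L n)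

/-- The (left) global dimension: the supremum of the projective dimensions of all modules. -/
def globalDimension (Γ : Type u) [Ring Γ] : WithBot ℕ∞ :=
  ⨆ M : ModuleCat.{u} Γ, projectiveDimension M

end

/-!
Both parts are proved for a pair of rings `A`, `B` and a bimodule `W` that is free of rank one on
either side with a common generator (`IsDualizing`), which makes them symmetric in left and right
modules. Write `E^i(L)` for `Ext^i(L, W)`, with `L` a module over one of the rings and `E^i(L)` a
module over the other, and `L^*` for `Hom(L, W)`.

The main tool is the transposed resolution. If `E^i(L) = 0` for `i < n`, then dualizing a free
resolution of `L` gives an exact sequence `0 → P₀^* → ⋯ → P_n^* → X → 0`. The module `E^n(L)` embeds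
into `X`, and `E^n(X)` is `L` if `n > 0` (for `n = 0` one only gets that the image of `E^0(X)` in
`E^0(E^0(L))` is a quotient of `L`). Moreover a nonzero map `S → X` with `S` of grade at least `n`
induces a nonzero map `E^n(X) → E^n(S)`: pass to `Ext^n(S, P₀^*)` by dimension shifting. These facts
are `exists_transpose_of_gradeGE` and `Detects`. If only `E^i(L) = 0` for `0 < i < n`, then `E^n(X)`
is the torsion submodule of `L`, the common kernel of all maps `L → W` (`exists_transpose`).

For the duality condition, let `L` be simple of grade `n`. It is annihilated by a maximal ideal of
the base ring, hence so is `E^n(L)`, which therefore is Artinian and has a simple submodule `S`. By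
the `(n,n)`-condition `S` has grade at least `n`, so that the composition `L → E^n(E^n(L)) →
E^n(S)`, whose image is that of `E^n(X)`, is nonzero and thus injective. Now let `Y` be the
transpose of `S`; then `L ⊆ E^n(S) ⊆ Y`, and the exact sequence `E^n(Y) → E^n(L) → E^{n+1}(Y/L)`
shows that the quotient of `E^n(L)` by a quotient of `S` embeds into `E^{n+1}(Y/L)`, which has
strong grade at least `n + 1`. As simple submodules of `E^n(L)` have grade exactly `n`, this forces
`E^n(L)` to have a unique simple submodule (`isSimpleModule_socExt`). As `L` embeds into `E^n` of
this socle, it is isomorphic to the socle of that module (`nonempty_socExt_socExt_equiv`).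

For the second part, let `L` be simple of grade `0` and reduced grade `n - 1`. Embed `L` into a free
module `F` such that every map `L → W` extends to `F`, and let `M = F / L`. Then `E^{n-1}(L) =
E^n(M)`, and `E^n(X)` is the torsion submodule `V` of `M`, where `X` is the transpose of `M`. Two
different simple submodules of `E^n(M) ⊆ X` would give a surjection of `V` onto a product of two
nonzero modules. But the preimage `P` of `V` in `F` satisfies `Ext^1(P, Y) = 0` for all finitely
generated `Y`, and restriction to `L` identifies its endomorphism ring with the division ring
`End(L)`; such a module does not map onto a product (`subsingleton_of_surjective_prod`).
-/

set_option linter.unusedSectionVars false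

noncomputable section

/-! ### Short exact sequences and functoriality of Ext -/

/-- The sequence `0 → K → P → L → 0` of modules is exact. -/
structure IsShortExact {A K P L : Type u} [Ring A] [AddCommGroup K] [Module A K]
    [AddCommGroup P] [Module A P] [AddCommGroup L] [Module A L]
    (f : K →ₗ[A] P) (g : P →ₗ[A] L) : Prop where
  injective : Function.Injective f
  exact : Function.Exact f g
  surjective : Function.Surjective g

namespace IsShortExact

variable {A K P L : Type u} [Ring A] [AddCommGroup K] [Module A K]
    [AddCommGroup P] [Module A P] [AddCommGroup L] [Module A L]
    {f : K →ₗ[A] P} {g : P →ₗ[A] L}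

theorem comp_eq_zero (h : IsShortExact f g) : g ∘ₗ f = 0 :=
  h.exact.linearMap_comp_eq_zero

/-- A short exact sequence of modules, as a short complex in the category of modules. -/
abbrev shortComplex (h : IsShortExact f g) : ShortComplex (ModuleCat.{u} A) :=
  ShortComplex.mk (ModuleCat.ofHom f) (ModuleCat.ofHom g)
    (by rw [← ModuleCat.ofHom_comp, h.comp_eq_zero]; rfl)

theorem shortExact (h : IsShortExact f g) : h.shortComplex.ShortExact where
  exact := (ShortComplex.ShortExact.moduleCat_exact_iff_function_exact _).mpr h.exact
  mono_f := (ModuleCat.mono_iff_injective _).mpr h.injective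
  epi_g := (ModuleCat.epi_iff_surjective _).mpr h.surjective

theorem subtype_ker (g : P →ₗ[A] L) (hg : Function.Surjective g) :
    IsShortExact (LinearMap.ker g).subtype g :=
  ⟨Subtype.val_injective, LinearMap.exact_subtype_ker_map g, hg⟩

theorem mkQ_range (f : K →ₗ[A] P) (hf : Function.Injective f) :
    IsShortExact f (LinearMap.range f).mkQ :=
  ⟨hf, LinearMap.exact_map_mkQ_range f, Submodule.mkQ_surjective _⟩

end IsShortExact

namespace ExtMod

variable {A B W : Type u} [Ring A] [Ring B] [AddCommGroup W] [Module A W] [Module B W]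
  [SMulCommClass B A W]
  {K P L : Type u} [AddCommGroup K] [Module A K] [AddCommGroup P] [Module A P]
  [AddCommGroup L] [Module A L]

theorem smul_def (b : B) {n : ℕ} (x : ExtMod A W L n) :
    b • x = Abelian.Ext.comp (C := ModuleCat.{u} A) x (Abelian.Ext.mk₀ (actionHom A W b))
      (add_zero n) := rfl

variable (B W)

/-- The map `Ext^n(L, W) → Ext^n(K, W)` induced by `f : K → L`. -/
def precomp (f : K →ₗ[A] L) (n : ℕ) : ExtMod A W L n →ₗ[B] ExtMod A W K n where
  toFun x := Abelian.Ext.comp (C := ModuleCat.{u} A) (Abelian.Ext.mk₀ (ModuleCat.ofHom f)) x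
    (zero_add n)
  map_add' _ _ := Abelian.Ext.comp_add (C := ModuleCat.{u} A) _ _ _ _
  map_smul' _ _ :=
    (Abelian.Ext.comp_assoc_of_third_deg_zero (C := ModuleCat.{u} A) _ _ _ (zero_add n)).symm

theorem precomp_comp (f : K →ₗ[A] P) (g : P →ₗ[A] L) (n : ℕ) :
    precomp B W (g ∘ₗ f) n = precomp B W f n ∘ₗ precomp B W g n := by
  ext x
  exact (Abelian.Ext.mk₀_comp_mk₀_assoc (C := ModuleCat.{u} A) _ _ _).symm

theorem precomp_id (n : ℕ) : precomp B W (LinearMap.id : L →ₗ[A] L) n = LinearMap.id := by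
  ext x
  exact Abelian.Ext.mk₀_id_comp (C := ModuleCat.{u} A) _

theorem precomp_zero (n : ℕ) : precomp B W (0 : K →ₗ[A] L) n = 0 := by
  ext x
  change Abelian.Ext.comp (C := ModuleCat.{u} A) (Abelian.Ext.mk₀ 0) x (zero_add n) = 0
  rw [Abelian.Ext.mk₀_zero]
  exact Abelian.Ext.zero_comp (C := ModuleCat.{u} A) _ 0 _ n (zero_add n)

/-- Isomorphic modules have isomorphic Ext groups. -/
def congrEquiv (e : K ≃ₗ[A] L) (n : ℕ) : ExtMod A W L n ≃ₗ[B] ExtMod A W K n :=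
  LinearEquiv.ofLinearMap (precomp B W (e : K →ₗ[A] L) n) (precomp B W (e.symm : L →ₗ[A] K) n)
    (by rw [← precomp_comp]; simp [precomp_id]) (by rw [← precomp_comp]; simp [precomp_id])

/-- The connecting map `Ext^n(K, W) → Ext^{n+1}(L, W)` of a short exact sequence
`0 → K → P → L → 0`. -/
def connecting {f : K →ₗ[A] P} {g : P →ₗ[A] L} (h : IsShortExact f g) (n : ℕ) :
    ExtMod A W K n →ₗ[B] ExtMod A W L (n + 1) where
  toFun x := Abelian.Ext.comp (C := ModuleCat.{u} A) h.shortExact.extClass x (add_comm 1 n)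
  map_add' _ _ := Abelian.Ext.comp_add (C := ModuleCat.{u} A) _ _ _ _
  map_smul' _ _ :=
    (Abelian.Ext.comp_assoc_of_third_deg_zero (C := ModuleCat.{u} A) _ _ _ (add_comm 1 n)).symm

variable {f : K →ₗ[A] P} {g : P →ₗ[A] L} (h : IsShortExact f g) (n : ℕ)
include h

theorem exact_precomp : Function.Exact (precomp B W g n) (precomp B W f n) := by
  intro x
  constructor
  · intro hx
    exact Abelian.Ext.contravariant_sequence_exact₂ h.shortExact _ x hx
  · rintro ⟨y, rfl⟩
    rw [← LinearMap.comp_apply, ← precomp_comp, h.comp_eq_zero, precomp_zero]; rfl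

theorem exact_precomp_connecting :
    Function.Exact (precomp B W f n) (connecting B W h n) := by
  intro x
  constructor
  · intro hx
    exact Abelian.Ext.contravariant_sequence_exact₁ h.shortExact _ x (add_comm 1 n) hx
  · rintro ⟨y, rfl⟩
    exact ShortComplex.ShortExact.extClass_comp_assoc h.shortExact (Y := ModuleCat.of A W) _
      (h := add_comm 1 n)

theorem exact_connecting_precomp :
    Function.Exact (connecting B W h n) (precomp B W g (n + 1)) := by
  intro x
  constructor
  · intro hx
    exact Abelian.Ext.contravariant_sequence_exact₃ h.shortExact _ x hx (add_comm 1 n)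
  · rintro ⟨y, rfl⟩
    exact ShortComplex.ShortExact.comp_extClass_assoc h.shortExact (h := add_comm 1 n) _

end ExtMod

/-! ### Vanishing of Ext and dimension shifting -/

namespace ExtMod

/-- The integers, lifted to the universe of the modules, act on every module by endomorphisms. They
serve as the second ring `B` in statements on Ext groups in which no second action is given. -/
instance smulCommClass_ulift_int (A W : Type u) [Ring A] [AddCommGroup W] [Module A W] :
    SMulCommClass (ULift.{u} ℤ) A W :=
  ⟨fun n a w => smul_comm n.down a w⟩

section Vanishing

variable {A B W : Type u} [Ring A] [Ring B] [AddCommGroup W] [Module A W] [Module B W]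
  [SMulCommClass B A W]
  {K P L : Type u} [AddCommGroup K] [Module A K] [AddCommGroup P] [Module A P]
  [AddCommGroup L] [Module A L]
  {f : K →ₗ[A] P} {g : P →ₗ[A] L} (h : IsShortExact f g) (n : ℕ)

variable (W L) in
instance subsingleton_of_projective [Module.Projective A L] :
    Subsingleton (ExtMod A W L (n + 1)) :=
  Abelian.Ext.subsingleton_of_projective (ModuleCat.of A L) (ModuleCat.of A W) n

include h

variable (B W) in
theorem connecting_surjective [Subsingleton (ExtMod A W P (n + 1))] :
    Function.Surjective (connecting B W h n) := fun x =>
  (exact_connecting_precomp B W h n x).mp (Subsingleton.elim _ _)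

variable (B W) in
theorem connecting_injective [Subsingleton (ExtMod A W P n)] :
    Function.Injective (connecting B W h n) := by
  rw [← LinearMap.ker_eq_bot, LinearMap.ker_eq_bot']
  intro x hx
  obtain ⟨y, rfl⟩ := (exact_precomp_connecting B W h n x).mp hx
  rw [Subsingleton.elim y 0, map_zero]

variable (B W) in
theorem precomp_surjective [Subsingleton (ExtMod A W L (n + 1))] :
    Function.Surjective (precomp B W f n) := fun x =>
  (exact_precomp_connecting B W h n x).mp (Subsingleton.elim _ _)

variable (B W) in
/-- Dimension shifting along a short exact sequence whose middle term has no relevant Ext. -/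
def shiftEquiv [Subsingleton (ExtMod A W P n)] [Subsingleton (ExtMod A W P (n + 1))] :
    ExtMod A W K n ≃ₗ[B] ExtMod A W L (n + 1) :=
  LinearEquiv.ofBijective (connecting B W h n)
    ⟨connecting_injective B W h n, connecting_surjective B W h n⟩

variable (W) in
theorem subsingleton_left [Subsingleton (ExtMod A W P n)]
    [Subsingleton (ExtMod A W L (n + 1))] : Subsingleton (ExtMod A W K n) :=
  (connecting_injective (ULift.{u} ℤ) W h n).subsingleton

variable (W) in
theorem subsingleton_middle [Subsingleton (ExtMod A W K n)]
    [Subsingleton (ExtMod A W L n)] : Subsingleton (ExtMod A W P n) := by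
  refine ⟨fun x y => sub_eq_zero.mp ?_⟩
  obtain ⟨z, hz⟩ := (exact_precomp (ULift.{u} ℤ) W h n (x - y)).mp (Subsingleton.elim _ _)
  rw [← hz, Subsingleton.elim z 0, map_zero]

variable (W) in
theorem subsingleton_right [Subsingleton (ExtMod A W K n)]
    [Subsingleton (ExtMod A W P (n + 1))] : Subsingleton (ExtMod A W L (n + 1)) :=
  (connecting_surjective (ULift.{u} ℤ) W h n).subsingleton

variable (W) in
theorem exists_extension [Subsingleton (ExtMod A W L 1)] (φ : K →ₗ[A] W) :
    ∃ ψ : P →ₗ[A] W, ψ ∘ₗ f = φ := by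
  obtain ⟨x, hx⟩ := precomp_surjective (ULift.{u} ℤ) W h 0
    (Abelian.Ext.mk₀ (ModuleCat.ofHom φ) : ExtMod A W K 0)
  obtain ⟨ψ, rfl⟩ := Abelian.Ext.mk₀_bijective _ _ |>.2 x
  refine ⟨ψ.hom, ?_⟩
  have := Abelian.Ext.mk₀_bijective _ _ |>.1 ((Abelian.Ext.mk₀_comp_mk₀ _ _).symm.trans hx)
  exact congrArg ModuleCat.Hom.hom this

variable (S : Type u) [AddCommGroup S] [Module A S]

theorem exists_lift [Subsingleton (ExtMod A K S 1)] (φ : S →ₗ[A] L) :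
    ∃ ψ : S →ₗ[A] P, g ∘ₗ ψ = φ := by
  obtain ⟨x, hx⟩ := Abelian.Ext.covariant_sequence_exact₃ (ModuleCat.of A S) h.shortExact
    (Abelian.Ext.mk₀ (ModuleCat.ofHom φ)) (zero_add 1)
    (Subsingleton.elim (α := ExtMod A K S 1) _ _)
  obtain ⟨ψ, rfl⟩ := Abelian.Ext.mk₀_bijective _ _ |>.2 x
  refine ⟨ψ.hom, ?_⟩
  have := Abelian.Ext.mk₀_bijective _ _ |>.1 ((Abelian.Ext.mk₀_comp_mk₀ _ _).symm.trans hx)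
  exact congrArg ModuleCat.Hom.hom this

theorem subsingleton_right_covariant [Subsingleton (ExtMod A P S n)]
    [Subsingleton (ExtMod A K S (n + 1))] : Subsingleton (ExtMod A L S n) := by
  refine subsingleton_of_forall_eq 0 fun x => ?_
  obtain ⟨y, rfl⟩ := Abelian.Ext.covariant_sequence_exact₃ (ModuleCat.of A S) h.shortExact
    x rfl (Subsingleton.elim (α := ExtMod A K S (n + 1)) _ _)
  rw [Subsingleton.elim (α := ExtMod A P S n) y 0]
  exact Abelian.Ext.zero_comp (C := ModuleCat.{u} A) _ n _ n (add_zero n)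

theorem comp_extClass_ne_zero [Subsingleton (ExtMod A P S n)] {x : ExtMod A L S n} (hx : x ≠ 0) :
    (Abelian.Ext.comp x h.shortExact.extClass rfl : ExtMod A K S (n + 1)) ≠ 0 := by
  intro h0
  obtain ⟨y, rfl⟩ := Abelian.Ext.covariant_sequence_exact₃ (ModuleCat.of A S) h.shortExact
    x rfl h0
  apply hx
  rw [Subsingleton.elim (α := ExtMod A P S n) y 0]
  exact Abelian.Ext.zero_comp (C := ModuleCat.{u} A) _ n _ n (add_zero n)

end Vanishing

section Zero

variable (A B W : Type u) [Ring A] [Ring B] [AddCommGroup W] [Module A W] [Module B W]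
  [SMulCommClass B A W] [SMulCommClass A B W]
  {K : Type u} (L : Type u) [AddCommGroup K] [Module A K] [AddCommGroup L] [Module A L]

/-- `Ext^0(L, W)` is the `B`-module of `A`-linear maps `L → W`. -/
def homEquiv : (L →ₗ[A] W) ≃ₗ[B] ExtMod A W L 0 where
  toFun φ := Abelian.Ext.mk₀ (ModuleCat.ofHom φ)
  map_add' φ ψ := by
    change Abelian.Ext.mk₀ (ModuleCat.ofHom φ + ModuleCat.ofHom ψ) = _
    exact Abelian.Ext.mk₀_add _ _
  map_smul' b φ := by
    have h : ModuleCat.ofHom (b • φ) = ModuleCat.ofHom φ ≫ actionHom A W b := rfl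
    exact (congrArg Abelian.Ext.mk₀ h).trans
      (Abelian.Ext.mk₀_comp_mk₀ (ModuleCat.ofHom φ) (actionHom A W b)).symm
  invFun x := (Abelian.Ext.homEquiv₀ x).hom
  left_inv φ := congrArg ModuleCat.Hom.hom (Abelian.Ext.homEquiv₀.right_inv (ModuleCat.ofHom φ))
  right_inv x := Abelian.Ext.homEquiv₀.left_inv x

variable {A L} in
theorem precomp_homEquiv (f : K →ₗ[A] L) (φ : L →ₗ[A] W) :
    precomp B W f 0 (homEquiv A B W L φ) = homEquiv A B W K (φ ∘ₗ f) :=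
  Abelian.Ext.mk₀_comp_mk₀ (C := ModuleCat.{u} A) _ _

end Zero

section Pi

variable {A : Type u} (W : Type u) [Ring A] [AddCommGroup W] [Module A W]
  (L : Type u) [AddCommGroup L] [Module A L]

theorem exists_proj_ne_zero {n k : ℕ} {x : ExtMod A (Fin k → W) L n} (hx : x ≠ 0) :
    ∃ i : Fin k, Abelian.Ext.comp (C := ModuleCat.{u} A) x
      (Abelian.Ext.mk₀ (ModuleCat.ofHom (LinearMap.proj i : (Fin k → W) →ₗ[A] W)))
        (add_zero n) ≠ 0 := by
  by_contra! hall
  apply hx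
  have hsum : 𝟙 (ModuleCat.of A (Fin k → W)) = ∑ i, ModuleCat.ofHom
      (LinearMap.proj i : (Fin k → W) →ₗ[A] W) ≫
        ModuleCat.ofHom (LinearMap.single A (fun _ : Fin k => W) i) := by
    rw [← ModuleCat.hom_injective.eq_iff]
    ext x i j
    simp [ModuleCat.hom_sum, Pi.single_apply, Finset.sum_ite_eq]
  have hmk : Abelian.Ext.mk₀ (𝟙 (ModuleCat.of A (Fin k → W))) = ∑ i, Abelian.Ext.comp
      (Abelian.Ext.mk₀ (ModuleCat.ofHom (LinearMap.proj i : (Fin k → W) →ₗ[A] W)))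
      (Abelian.Ext.mk₀ (ModuleCat.ofHom (LinearMap.single A (fun _ : Fin k => W) i)))
        (add_zero 0) := by
    rw [hsum, Abelian.Ext.mk₀_sum]
    simp only [Abelian.Ext.mk₀_comp_mk₀]
  have hid : x = Abelian.Ext.comp (C := ModuleCat.{u} A) x
      (Abelian.Ext.mk₀ (𝟙 (ModuleCat.of A (Fin k → W)))) (add_zero n) :=
    (Abelian.Ext.comp_mk₀_id (C := ModuleCat.{u} A) x).symm
  rw [hid, hmk]
  refine (Abelian.Ext.comp_sum (C := ModuleCat.{u} A) _ _ _).trans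
    (Finset.sum_eq_zero fun i _ => ?_)
  refine (Abelian.Ext.comp_assoc_of_third_deg_zero (C := ModuleCat.{u} A) _ _ _ _).symm.trans ?_
  rw [hall i]
  exact Abelian.Ext.zero_comp (C := ModuleCat.{u} A) _ n _ n (add_zero n)

theorem subsingleton_pi (n k : ℕ) [Subsingleton (ExtMod A W L n)] :
    Subsingleton (ExtMod A (Fin k → W) L n) := by
  refine subsingleton_of_forall_eq 0 fun x => ?_
  by_contra hx
  obtain ⟨i, hi⟩ := exists_proj_ne_zero W L hx
  exact hi (Subsingleton.elim (α := ExtMod A W L n) _ _)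

end Pi

end ExtMod

/-! ### Grades -/

section Grade

variable (A W L : Type u) [Ring A] [AddCommGroup W] [Module A W] [AddCommGroup L] [Module A L]

/-- `L` has grade at least `n`: the groups `Ext^i(L, W)` vanish for `i < n`. -/
def GradeGE (n : ℕ) : Prop := ∀ i < n, Subsingleton (ExtMod A W L i)

/-- `L` has strong grade at least `n`: all its submodules have grade at least `n`. -/
def StrongGradeGE (n : ℕ) : Prop := ∀ M : Submodule A L, GradeGE A W M n

variable {A W L}

theorem le_moduleGrade_iff {n : ℕ} : (n : ℕ∞) ≤ moduleGrade A W L ↔ GradeGE A W L n := by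
  simp only [moduleGrade, le_iInf_iff, Nat.cast_le, GradeGE]
  refine forall_congr' fun i => ?_
  rw [← not_nontrivial_iff_subsingleton]
  constructor
  · intro h hi hn
    exact absurd (h hn) (by omega)
  · intro h hn
    by_contra hi
    exact h (by omega) hn

theorem moduleGrade_eq_iff {n : ℕ} : moduleGrade A W L = n ↔
    GradeGE A W L n ∧ Nontrivial (ExtMod A W L n) := by
  have h : Nontrivial (ExtMod A W L n) → moduleGrade A W L ≤ n := fun hn =>
    iInf₂_le (f := fun (i : ℕ) (_ : Nontrivial (ExtMod A W L i)) => (i : ℕ∞)) n hn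
  rw [← le_moduleGrade_iff]
  refine ⟨fun hL => ⟨hL.ge, ?_⟩, fun hL => le_antisymm (h hL.2) hL.1⟩
  by_contra hn
  rw [not_nontrivial_iff_subsingleton] at hn
  have h1 : GradeGE A W L (n + 1) := fun i hi => by
    rcases Nat.lt_succ_iff_lt_or_eq.mp hi with h' | rfl
    · exact le_moduleGrade_iff.mp hL.ge i h'
    · exact hn
  have h2 := le_moduleGrade_iff.mpr h1
  rw [hL, Nat.cast_le] at h2
  omega

theorem le_strongGrade_iff {n : ℕ} : (n : ℕ∞) ≤ strongGrade A W L ↔ StrongGradeGE A W L n := by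
  simp only [strongGrade, le_iInf_iff, le_moduleGrade_iff, StrongGradeGE]

theorem GradeGE.congr {n : ℕ} {M : Type u} [AddCommGroup M] [Module A M] (h : GradeGE A W L n)
    (e : M ≃ₗ[A] L) : GradeGE A W M n := fun i hi =>
  have := h i hi
  (ExtMod.congrEquiv (ULift.{u} ℤ) W e i).symm.injective.subsingleton

theorem StrongGradeGE.of_injective {n : ℕ} {M : Type u} [AddCommGroup M] [Module A M]
    (h : StrongGradeGE A W L n) (f : M →ₗ[A] L) (hf : Function.Injective f) :
    StrongGradeGE A W M n := fun S =>
  (h (S.map f)).congr (Submodule.equivMapOfInjective f hf S)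

theorem StrongGradeGE.gradeGE {n : ℕ} (h : StrongGradeGE A W L n) : GradeGE A W L n :=
  (h ⊤).congr Submodule.topEquiv.symm

theorem GradeGE.mono {m n : ℕ} (h : GradeGE A W L n) (hmn : m ≤ n) : GradeGE A W L m :=
  fun i hi => h i (hi.trans_le hmn)

theorem GradeGE.hom_eq_zero {n : ℕ} (h : GradeGE A W L n) (hn : 0 < n) (f : L →ₗ[A] W) :
    f = 0 := by
  have := h 0 hn
  have h0 : Abelian.Ext.mk₀ (ModuleCat.ofHom f) = Abelian.Ext.mk₀ (ModuleCat.ofHom 0) :=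
    Subsingleton.elim (α := ExtMod A W L 0) _ _
  exact congrArg ModuleCat.Hom.hom (Abelian.Ext.mk₀_bijective _ _ |>.1 h0)

end Grade

/-! ### Duality for free modules -/

section Dual

variable (A B W : Type u) [Ring A] [Ring B] [AddCommGroup W] [Module A W] [Module B W]
  [SMulCommClass B A W] [SMulCommClass A B W]

/-- The bimodule `W` is free of rank one on either side, with a common generator. -/
def IsDualizing : Prop :=
  ∃ w : W, Function.Bijective (fun a : A => a • w) ∧ Function.Bijective (fun b : B => b • w)

/-- The evaluation map from a module to its double dual with respect to `W`. -/
def evalHom (L : Type u) [AddCommGroup L] [Module A L] :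
    L →ₗ[A] ((L →ₗ[A] W) →ₗ[B] W) where
  toFun x :=
    { toFun := fun φ => φ x
      map_add' := fun _ _ => rfl
      map_smul' := fun _ _ => rfl }
  map_add' x y := by ext φ; exact map_add φ x y
  map_smul' a x := by ext φ; exact map_smul φ a x

variable {A W} in
/-- The `B`-linear dual of an `A`-linear map. -/
def dualMap {K L : Type u} [AddCommGroup K] [Module A K] [AddCommGroup L] [Module A L]
    (f : K →ₗ[A] L) : (L →ₗ[A] W) →ₗ[B] (K →ₗ[A] W) :=
  LinearMap.lcomp B W f

@[simp] theorem evalHom_apply {L : Type u} [AddCommGroup L] [Module A L] (x : L)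
    (φ : L →ₗ[A] W) : evalHom A B W L x φ = φ x := rfl

variable {A W} in
@[simp] theorem dualMap_apply {K L : Type u} [AddCommGroup K] [Module A K] [AddCommGroup L]
    [Module A L] (f : K →ₗ[A] L) (φ : L →ₗ[A] W) : dualMap B f φ = φ ∘ₗ f := rfl

variable {A B W}

theorem IsDualizing.symm (h : IsDualizing A B W) : IsDualizing B A W :=
  let ⟨w, h₁, h₂⟩ := h
  ⟨w, h₂, h₁⟩

theorem IsDualizing.nonempty_equiv (h : IsDualizing A B W) : Nonempty (A ≃ₗ[A] W) :=
  let ⟨w, h₁, _⟩ := h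
  ⟨LinearEquiv.ofBijective (LinearMap.toSpanSingleton A W w) h₁⟩

/-- The dual of a free module of rank `k` is `W ^ k`. -/
def dualPiEquiv (A B W : Type u) [Ring A] [Ring B] [AddCommGroup W] [Module A W] [Module B W]
    [SMulCommClass B A W] [SMulCommClass A B W] (k : ℕ) :
    ((Fin k → A) →ₗ[A] W) ≃ₗ[B] (Fin k → W) :=
  ((Pi.basisFun A (Fin k)).constr B).symm

theorem IsDualizing.projective_pi (h : IsDualizing A B W) (k : ℕ) :
    Module.Projective A (Fin k → W) :=
  have ⟨e⟩ := h.nonempty_equiv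
  Module.Projective.of_equiv (LinearEquiv.piCongrRight fun _ : Fin k => e)

theorem IsDualizing.finite_pi (h : IsDualizing A B W) (k : ℕ) :
    Module.Finite A (Fin k → W) :=
  have ⟨e⟩ := h.nonempty_equiv
  Module.Finite.equiv (LinearEquiv.piCongrRight fun _ : Fin k => e)

theorem IsDualizing.projective_dual (h : IsDualizing A B W) (k : ℕ) :
    Module.Projective B ((Fin k → A) →ₗ[A] W) :=
  have := h.symm.projective_pi k
  Module.Projective.of_equiv (dualPiEquiv A B W k).symm

theorem IsDualizing.finite_dual (h : IsDualizing A B W) (k : ℕ) :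
    Module.Finite B ((Fin k → A) →ₗ[A] W) :=
  have := h.symm.finite_pi k
  Module.Finite.equiv (dualPiEquiv A B W k).symm

/-- Free modules of finite rank are reflexive. -/
theorem IsDualizing.evalHom_bijective (h : IsDualizing A B W) (k : ℕ) :
    Function.Bijective (evalHom A B W (Fin k → A)) := by
  obtain ⟨w, hA, hB⟩ := h
  let c (i : Fin k) : (Fin k → A) →ₗ[A] W := LinearMap.toSpanSingleton A W w ∘ₗ LinearMap.proj i
  constructor
  · rw [← LinearMap.ker_eq_bot, LinearMap.ker_eq_bot']
    intro p hp
    ext i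
    apply hA.1
    have : c i p = 0 := DFunLike.congr_fun hp (c i)
    simpa [c] using this
  · intro ξ
    choose p hp using fun i => hA.2 (ξ (c i))
    refine ⟨p, LinearMap.ext fun φ => ?_⟩
    choose b hb using fun i => hB.2 (φ (Pi.single i 1))
    have hφ : φ = ∑ i, b i • c i := by
      refine LinearMap.pi_ext' fun i => LinearMap.ext_ring ?_
      simp only [LinearMap.comp_apply, LinearMap.single_apply, LinearMap.sum_apply,
        LinearMap.smul_apply, c, LinearMap.proj_apply, LinearMap.toSpanSingleton_apply]
      rw [Finset.sum_eq_single i]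
      · simpa using (hb i).symm
      · intro j _ hj
        simp [Pi.single_eq_of_ne hj]
      · simp
    rw [evalHom_apply]
    conv_rhs => rw [hφ]
    conv_lhs => rw [hφ]
    simp only [LinearMap.sum_apply, LinearMap.smul_apply, map_sum, map_smul]
    refine Finset.sum_congr rfl fun i _ => ?_
    rw [← hp i]; rfl

end Dual

/-! ### Ext groups of simple modules over a finite algebra -/

section Central

variable {R : Type*} [CommRing R] {A B W : Type u} [Ring A] [Ring B] [Algebra R A] [Algebra R B]
  [AddCommGroup W] [Module A W] [Module B W] [SMulCommClass B A W]

/-- The category of modules over an `R`-algebra is `R`-linear. -/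
abbrev moduleCatLinear (R : Type*) [CommRing R] (A : Type u) [Ring A] [Algebra R A] :
    Linear R (ModuleCat.{u} A) :=
  letI (M : ModuleCat.{u} A) : Module R M := Module.restrictScalars R A M
  haveI (M : ModuleCat.{u} A) : IsScalarTower R A M := IsScalarTower.restrictScalars R A M
  { homModule := fun _ _ => inferInstance }

/-- A scalar that annihilates `L` annihilates the groups `Ext^n(L, W)`, because the two actions of
a central scalar on them, through `L` and through `W`, agree. -/
theorem ExtMod.smul_eq_zero_of_annihilates
    (hW : ∀ (r : R) (w : W), algebraMap R A r • w = algebraMap R B r • w)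
    {L : Type u} [AddCommGroup L] [Module A L] (r : R) (hr : ∀ x : L, algebraMap R A r • x = 0)
    {n : ℕ} (x : ExtMod A W L n) : algebraMap R B r • x = 0 := by
  let := moduleCatLinear R A
  have h1 : actionHom A W (algebraMap R B r) = r • 𝟙 (ModuleCat.of A W) := by
    ext w
    exact (hW r w).symm
  have h2 : r • 𝟙 (ModuleCat.of A L) = 0 := by
    ext y
    exact hr y
  have h3 (y : Abelian.Ext (ModuleCat.of A L) (ModuleCat.of A W) n) :
      y.comp (Abelian.Ext.mk₀ (r • 𝟙 (ModuleCat.of A W))) (add_zero n) = 0 := by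
    calc y.comp (Abelian.Ext.mk₀ (r • 𝟙 (ModuleCat.of A W))) (add_zero n)
        = (Abelian.Ext.mk₀ (r • 𝟙 (ModuleCat.of A L))).comp y (zero_add n) := by
          simp only [Abelian.Ext.mk₀_smul, Abelian.Ext.comp_smul, Abelian.Ext.smul_comp,
            Abelian.Ext.comp_mk₀_id, Abelian.Ext.mk₀_id_comp]
      _ = 0 := by rw [h2, Abelian.Ext.mk₀_zero, Abelian.Ext.zero_comp]
  rw [ExtMod.smul_def, h1]
  exact h3 x

/-- A simple module over a finite `R`-algebra is annihilated by a maximal ideal of `R`. -/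
theorem exists_isMaximal_annihilates [Module.Finite R A] (L : Type u) [AddCommGroup L]
    [Module A L] [IsSimpleModule A L] :
    ∃ m : Ideal R, m.IsMaximal ∧ ∀ r ∈ m, ∀ x : L, algebraMap R A r • x = 0 := by
  let : Module R L := Module.restrictScalars R A L
  have : IsScalarTower R A L := IsScalarTower.restrictScalars R A L
  have : Module.Finite A L := inferInstance
  have : Module.Finite R L := Module.Finite.trans A L
  have : Nontrivial L := IsSimpleModule.nontrivial A L
  obtain ⟨N, hN, -⟩ := (eq_top_or_exists_le_coatom (⊥ : Submodule R L)).resolve_left bot_ne_top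
  have hs : IsSimpleModule R (L ⧸ N) := isSimpleModule_iff_isCoatom.mpr hN
  refine ⟨Module.annihilator R (L ⧸ N), ?_, ?_⟩
  · exact IsSimpleModule.annihilator_isMaximal
  · intro r hr x
    let φ : L →ₗ[A] L :=
      { toFun := fun x => algebraMap R A r • x
        map_add' := smul_add _
        map_smul' := fun a x => by
          rw [smul_smul, Algebra.commutes r a, ← smul_smul]; rfl }
    rcases LinearMap.bijective_or_eq_zero φ with h | h
    · exfalso
      apply hN.1
      rw [eq_top_iff]
      rintro y -
      obtain ⟨z, rfl⟩ := h.2 y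
      change algebraMap R A r • z ∈ N
      rw [algebraMap_smul, ← Submodule.Quotient.mk_eq_zero, Submodule.Quotient.mk_smul]
      exact Module.mem_annihilator.mp hr _
    · exact DFunLike.congr_fun h x

/-- Over a finite algebra, a finitely generated module `Ext^n(L, W)` is Artinian when `L` is
simple. -/
theorem ExtMod.isArtinian_of_isSimpleModule [Module.Finite R A] [Module.Finite R B]
    (hW : ∀ (r : R) (w : W), algebraMap R A r • w = algebraMap R B r • w)
    (L : Type u) [AddCommGroup L] [Module A L] [IsSimpleModule A L] (n : ℕ)
    [Module.Finite B (ExtMod A W L n)] : IsArtinian B (ExtMod A W L n) := by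
  obtain ⟨m, hm, hmL⟩ := exists_isMaximal_annihilates (R := R) (A := A) L
  let : Module R (ExtMod A W L n) := Module.restrictScalars R B _
  have : IsScalarTower R B (ExtMod A W L n) := IsScalarTower.restrictScalars R B _
  have : Module.Finite R (ExtMod A W L n) := Module.Finite.trans B _
  have hT : Module.IsTorsionBySet R (ExtMod A W L n) (m : Set R) := fun x r => by
    rw [← algebraMap_smul B]
    exact ExtMod.smul_eq_zero_of_annihilates hW (r : R) (hmL r r.2) x
  let := hT.module
  let : Field (R ⧸ m) := Ideal.Quotient.field m
  have : IsScalarTower R (R ⧸ m) (ExtMod A W L n) := hT.isScalarTower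
  have : Module.Finite (R ⧸ m) (ExtMod A W L n) := Module.Finite.of_restrictScalars_finite R _ _
  have : IsArtinian (R ⧸ m) (ExtMod A W L n) := inferInstance
  have : IsArtinian R (ExtMod A W L n) :=
    isArtinian_of_surjective_algebraMap (S := R) (R := R ⧸ m) Ideal.Quotient.mk_surjective
  exact isArtinian_of_tower R this

end Central

/-! ### Detecting morphisms by Ext groups -/

/-- Every nonzero class `x` in `Ext^m(S, X)` remains nonzero after multiplication with some class
in `Ext^j(X, W)`, as soon as the groups `Ext^i(S, W)` vanish for `i < m + j`. For `m = 0` it says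
that a nonzero map `S → X` induces a nonzero map `Ext^j(X, W) → Ext^j(S, W)`. -/
def Detects (B W X : Type u) [Ring B] [AddCommGroup W] [Module B W] [AddCommGroup X] [Module B X]
    (j : ℕ) : Prop :=
  ∀ (S : Type u) [AddCommGroup S] [Module B S] (m p : ℕ) (h : m + j = p) (x : ExtMod B X S m),
    x ≠ 0 → GradeGE B W S p → ∃ y : ExtMod B W X j,
      (Abelian.Ext.comp (C := ModuleCat.{u} B) x y h : ExtMod B W S p) ≠ 0

section Detects

variable {B W X : Type u} [Ring B] [AddCommGroup W] [Module B W] [AddCommGroup X] [Module B X]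

theorem ExtMod.eq_zero_of_comp_equiv_eq_zero {Y Y' L : Type u} [AddCommGroup Y] [Module B Y]
    [AddCommGroup Y'] [Module B Y'] [AddCommGroup L] [Module B L] (e : Y ≃ₗ[B] Y') {n : ℕ}
    {x : Abelian.Ext (ModuleCat.of B L) (ModuleCat.of B Y) n}
    (hx : x.comp (Abelian.Ext.mk₀ e.toModuleIso.hom) (add_zero n) = 0) : x = 0 := by
  have := congrArg (fun z => z.comp (Abelian.Ext.mk₀ e.toModuleIso.inv) (add_zero n)) hx
  simpa only [Abelian.Ext.comp_assoc_of_third_deg_zero, Abelian.Ext.mk₀_comp_mk₀,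
    Iso.hom_inv_id, Abelian.Ext.comp_mk₀_id, Abelian.Ext.zero_comp] using this

theorem ExtMod.subsingleton_congr {Y Y' L : Type u} [AddCommGroup Y] [Module B Y]
    [AddCommGroup Y'] [Module B Y'] [AddCommGroup L] [Module B L] (e : Y ≃ₗ[B] Y') (n : ℕ)
    [Subsingleton (ExtMod B Y' L n)] : Subsingleton (ExtMod B Y L n) :=
  subsingleton_of_forall_eq 0 fun _ => ExtMod.eq_zero_of_comp_equiv_eq_zero e
    (Subsingleton.elim (α := ExtMod B Y' L n) _ _)

/-- Powers of `W` have enough projections to `W` to detect classes. -/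
theorem detects_zero {k : ℕ} (e : X ≃ₗ[B] (Fin k → W)) : Detects B W X 0 := by
  intro S _ _ m p h x hx _
  obtain rfl : m = p := by omega
  obtain ⟨i, hi⟩ := ExtMod.exists_proj_ne_zero W S
    (fun h => hx (ExtMod.eq_zero_of_comp_equiv_eq_zero e h))
  refine ⟨Abelian.Ext.mk₀ (e.toModuleIso.hom ≫
    ModuleCat.ofHom (LinearMap.proj i : (Fin k → W) →ₗ[B] W)), fun h => hi ?_⟩
  rw [← h, ← Abelian.Ext.mk₀_comp_mk₀]
  exact Abelian.Ext.comp_assoc_of_third_deg_zero (C := ModuleCat.{u} B) _ _ _ _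

/-- Along `0 → X' → G → X → 0` with `G` a power of `W`, a nonzero class in `Ext^m(S, X)` has a
nonzero image in `Ext^{m+1}(S, X')`, since `Ext^m(S, G) = 0`. -/
theorem Detects.succ {k j : ℕ} {X' G : Type u} [AddCommGroup X'] [Module B X'] [AddCommGroup G]
    [Module B G] {f : X' →ₗ[B] G} {g : G →ₗ[B] X} (h : IsShortExact f g) (e : G ≃ₗ[B] (Fin k → W))
    (hX : Detects B W X' j) : Detects B W X (j + 1) := by
  intro S _ _ m p hp x hx hS
  have := hS m (by omega)
  have := ExtMod.subsingleton_pi (A := B) W S m k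
  have := ExtMod.subsingleton_congr (L := S) e m
  obtain ⟨y, hy⟩ := hX S (m + 1) p (by omega) _ (ExtMod.comp_extClass_ne_zero h m S hx) hS
  refine ⟨Abelian.Ext.comp h.shortExact.extClass y (add_comm 1 j), fun h0 => hy ?_⟩
  rw [← h0]
  exact Abelian.Ext.comp_assoc (C := ModuleCat.{u} B) _ _ _ _ _ (by omega)

end Detects

/-! ### The transposed resolution -/

theorem LinearMap.exists_comp_eq_of_surjective {A M N Q : Type*} [Ring A] [AddCommGroup M]
    [Module A M] [AddCommGroup N] [Module A N] [AddCommGroup Q] [Module A Q] (u : M →ₗ[A] N)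
    (hu : Function.Surjective u) (v : M →ₗ[A] Q) (h : LinearMap.ker u ≤ LinearMap.ker v) :
    ∃ w : N →ₗ[A] Q, w ∘ₗ u = v := by
  refine ⟨(LinearMap.ker u).liftQ v h ∘ₗ (u.quotKerEquivOfSurjective hu).symm, ?_⟩
  ext x
  have : (u.quotKerEquivOfSurjective hu).symm (u x) = (LinearMap.ker u).mkQ x := by
    rw [LinearEquiv.symm_apply_eq]; rfl
  simp [this]

theorem LinearMap.nonempty_equiv_of_ker_eq {A M N Q : Type*} [Ring A] [AddCommGroup M]
    [Module A M] [AddCommGroup N] [Module A N] [AddCommGroup Q] [Module A Q] (u : M →ₗ[A] N)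
    (hu : Function.Surjective u) (v : M →ₗ[A] Q) (hv : Function.Surjective v)
    (h : LinearMap.ker u = LinearMap.ker v) : Nonempty (N ≃ₗ[A] Q) :=
  ⟨(u.quotKerEquivOfSurjective hu).symm ≪≫ₗ Submodule.quotEquivOfEq _ _ h ≪≫ₗ
    v.quotKerEquivOfSurjective hv⟩

theorem IsShortExact.liftQ_mkQ {A M N : Type u} [Ring A] [AddCommGroup M]
    [Module A M] [AddCommGroup N] [Module A N] (u : M →ₗ[A] N) {p : Submodule A M}
    {q : Submodule A N} (hp : p = LinearMap.ker u) (hq : q = LinearMap.range u) :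
    IsShortExact (p.liftQ u hp.le) q.mkQ where
  injective := by
    rw [← LinearMap.ker_eq_bot, Submodule.ker_liftQ_eq_bot _ _ _ hp.ge]
  exact := by
    rw [LinearMap.exact_iff, Submodule.ker_mkQ, Submodule.range_liftQ, hq]
  surjective := Submodule.mkQ_surjective _

section Tower

variable {A B W : Type u} [Ring A] [Ring B] [AddCommGroup W] [Module A W] [Module B W]
  [SMulCommClass B A W] [SMulCommClass A B W]

variable (A W) in
/-- The torsion submodule: the common kernel of all linear maps from `L` to `W`. -/
def torsionSubmodule (L : Type u) [AddCommGroup L] [Module A L] : Submodule A L :=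
  ⨅ f : L →ₗ[A] W, LinearMap.ker f

theorem mem_torsionSubmodule {L : Type u} [AddCommGroup L] [Module A L] {x : L} :
    x ∈ torsionSubmodule A W L ↔ ∀ f : L →ₗ[A] W, f x = 0 := by
  simp [torsionSubmodule]

variable {K P L : Type u} [AddCommGroup K] [Module A K]
  [AddCommGroup P] [Module A P] [AddCommGroup L] [Module A L]
  {f : K →ₗ[A] P} {g : P →ₗ[A] L}

variable (B W) in
/-- The presentation of `Ext^1(L, W)` by a short exact sequence `0 → K → P → L → 0`. -/
def dualToExtOne (h : IsShortExact f g) : (K →ₗ[A] W) →ₗ[B] ExtMod A W L 1 :=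
  ExtMod.connecting B W h 0 ∘ₗ (ExtMod.homEquiv A B W K).toLinearMap

theorem dualToExtOne_surjective (h : IsShortExact f g) [Module.Projective A P] :
    Function.Surjective (dualToExtOne B W h) :=
  (ExtMod.connecting_surjective B W h 0).comp (ExtMod.homEquiv A B W K).surjective

theorem ker_dualToExtOne (h : IsShortExact f g) :
    LinearMap.ker (dualToExtOne B W h) = LinearMap.range (dualMap B f : (P →ₗ[A] W) →ₗ[B] _) := by
  ext φ
  rw [LinearMap.mem_ker, dualToExtOne, LinearMap.comp_apply]
  refine (ExtMod.exact_precomp_connecting B W h 0 _).trans ?_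
  constructor
  · rintro ⟨x, hx⟩
    obtain ⟨ψ, rfl⟩ := (ExtMod.homEquiv A B W P).surjective x
    rw [ExtMod.precomp_homEquiv] at hx
    exact ⟨ψ, (ExtMod.homEquiv A B W K).injective hx⟩
  · rintro ⟨ψ, rfl⟩
    exact ⟨ExtMod.homEquiv A B W P ψ, ExtMod.precomp_homEquiv ..⟩

theorem dualMap_injective (hg : Function.Surjective g) :
    Function.Injective (dualMap B g : (L →ₗ[A] W) →ₗ[B] _) := fun φ ψ h => by
  ext x
  obtain ⟨y, rfl⟩ := hg x
  exact DFunLike.congr_fun h y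

/-- Exactness of the dual of a right exact sequence `P' → P → L → 0`. -/
theorem mem_range_dualMap {P' : Type u} [AddCommGroup P'] [Module A P'] {d : P' →ₗ[A] P}
    (hg : Function.Surjective g) (hd : LinearMap.range d = LinearMap.ker g) (φ : P →ₗ[A] W) :
    φ ∈ LinearMap.range (dualMap B g) ↔ φ ∘ₗ d = 0 := by
  constructor
  · rintro ⟨ψ, rfl⟩
    ext x
    have : d x ∈ LinearMap.ker g := hd ▸ ⟨x, rfl⟩
    simp [LinearMap.mem_ker.mp this]
  · intro h
    obtain ⟨ψ, hψ⟩ := LinearMap.exists_comp_eq_of_surjective g hg φ (by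
      rw [← hd]; rintro _ ⟨x, rfl⟩; exact DFunLike.congr_fun h x)
    exact ⟨ψ, hψ⟩

/-- For a presentation `P₁ → P₀ → L → 0` by free modules, the group `Ext^1` of the cokernel of the
dual map `P₀^* → P₁^*` is the torsion submodule of `L`. -/
theorem nonempty_extOne_transpose_equiv (hW : IsDualizing A B W) {a b : ℕ}
    (π : (Fin a → A) →ₗ[A] L) (hπ : Function.Surjective π)
    (d : (Fin b → A) →ₗ[A] (Fin a → A)) (hd : LinearMap.range d = LinearMap.ker π) :
    Nonempty (ExtMod B W (((Fin b → A) →ₗ[A] W) ⧸ LinearMap.range (dualMap (W := W) B d)) 1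
      ≃ₗ[A] torsionSubmodule A W L) := by
  have := hW.projective_dual b
  let T := LinearMap.range (dualMap (W := W) B d)
  have hT : IsShortExact T.subtype T.mkQ :=
    ⟨Subtype.val_injective, LinearMap.exact_subtype_mkQ T, Submodule.mkQ_surjective _⟩
  let ev := LinearEquiv.ofBijective _ (hW.evalHom_bijective a)
  let χ : (T →ₗ[B] W) →ₗ[A] (Fin a → A) :=
    ev.symm.toLinearMap ∘ₗ dualMap A (dualMap (W := W) B d).rangeRestrict
  have hχ (ξ : T →ₗ[B] W) (φ : (Fin a → A) →ₗ[A] W) :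
      φ (χ ξ) = ξ ((dualMap (W := W) B d).rangeRestrict φ) :=
    DFunLike.congr_fun (ev.apply_symm_apply
      (dualMap A (dualMap (W := W) B d).rangeRestrict ξ)) φ
  have hχt (ξ : T →ₗ[B] W) : (π ∘ₗ χ) ξ ∈ torsionSubmodule A W L := by
    rw [mem_torsionSubmodule]
    intro f
    have h0 : (dualMap (W := W) B d).rangeRestrict (f ∘ₗ π) = 0 := by
      ext1
      exact (mem_range_dualMap (B := B) hπ hd _).mp ⟨f, rfl⟩
    exact (hχ ξ (f ∘ₗ π)).trans (by rw [h0, map_zero])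
  refine LinearMap.nonempty_equiv_of_ker_eq (dualToExtOne A W hT) (dualToExtOne_surjective hT)
    (LinearMap.codRestrict _ (π ∘ₗ χ) hχt) ?_ ?_
  · rintro ⟨x, hx⟩
    obtain ⟨p, rfl⟩ := hπ x
    obtain ⟨ξ, hξ⟩ := LinearMap.exists_comp_eq_of_surjective
      (dualMap (W := W) B d).rangeRestrict (LinearMap.surjective_rangeRestrict _)
      (evalHom A B W _ p) (by
        intro φ hφ
        rw [LinearMap.ker_rangeRestrict, LinearMap.mem_ker] at hφ
        obtain ⟨ψ, rfl⟩ := (mem_range_dualMap (B := B) hπ hd φ).mpr hφ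
        exact mem_torsionSubmodule.mp hx ψ)
    refine ⟨ξ, Subtype.ext ?_⟩
    change π (χ ξ) = π p
    congr 1
    apply ev.injective
    refine (ev.apply_symm_apply _).trans ?_
    exact hξ
  · rw [ker_dualToExtOne, LinearMap.ker_codRestrict]
    ext ξ
    rw [LinearMap.mem_ker, LinearMap.comp_apply, ← LinearMap.mem_ker, ← hd]
    constructor
    · rintro ⟨ζ, rfl⟩
      obtain ⟨q, rfl⟩ := (hW.evalHom_bijective b).2 ζ
      refine ⟨q, ev.injective ?_⟩
      refine Eq.trans ?_ (ev.apply_symm_apply _).symm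
      rfl
    · rintro ⟨q, hq⟩
      refine ⟨evalHom A B W _ q, ?_⟩
      ext ⟨_, φ, rfl⟩
      refine Eq.trans ?_ (hχ ξ φ)
      rw [← hq]; rfl

end Tower

section Stage

variable (A B W : Type u) [Ring A] [Ring B] [AddCommGroup W] [Module A W] [Module B W]
  [SMulCommClass B A W] [SMulCommClass A B W]

/-- The `j`-th stage of the transposed resolution of `L`: the `j`-th syzygy `K` of `L` with a free
cover `P → K`, and a surjection `ψ : K^* → Ext^j(L, W)`. The transposed module of the stage is the
quotient `X` of `P^*` by the image of `ker ψ ⊆ K^*`. If `… → P₁ → P₀ → L` is the free resolution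
that is built in this way, then `X` is the cokernel of `P_{j-1}^* → P_j^*`. -/
structure TransposeStage (L : Type u) [AddCommGroup L] [Module A L] (j : ℕ) where
  /-- the syzygy -/
  K : Type u
  [addCommGroup : AddCommGroup K]
  [module : Module A K]
  finite : Module.Finite A K
  /-- the rank of the free cover of the syzygy -/
  rank : ℕ
  /-- the free cover of the syzygy -/
  π : (Fin rank → A) →ₗ[A] K
  surjective_π : Function.Surjective π
  /-- the presentation of `Ext^j(L, W)` by the dual of the syzygy -/
  ψ : (K →ₗ[A] W) →ₗ[B] ExtMod A W L j
  surjective_ψ : Function.Surjective ψ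
  shift : ∀ i m, 1 ≤ i → i + j = m → Nonempty (ExtMod A W L m ≃ₗ[B] ExtMod A W K i)
  extEquiv : Nonempty (ExtMod B W (((Fin rank → A) →ₗ[A] W) ⧸ (LinearMap.ker ψ).map (dualMap B π))
    j ≃ₗ[A] torsionSubmodule A W L)
  detects : GradeGE A W L 1 →
    Detects B W (((Fin rank → A) →ₗ[A] W) ⧸ (LinearMap.ker ψ).map (dualMap B π)) j

attribute [instance] TransposeStage.addCommGroup TransposeStage.module

variable {A B W} [IsNoetherianRing A] (hW : IsDualizing A B W)
  {L : Type u} [AddCommGroup L] [Module A L]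
include hW

theorem TransposeStage.nonempty_one [Module.Finite A L] :
    Nonempty (TransposeStage A B W L 1) := by
  obtain ⟨a, π₀, hπ₀⟩ := Module.Finite.exists_fin' A L
  have h₀ := IsShortExact.subtype_ker π₀ hπ₀
  obtain ⟨b, π₁, hπ₁⟩ := Module.Finite.exists_fin' A (LinearMap.ker π₀)
  let d := (LinearMap.ker π₀).subtype ∘ₗ π₁
  have hd : LinearMap.range d = LinearMap.ker π₀ := by
    rw [LinearMap.range_comp, LinearMap.range_eq_top.mpr hπ₁, Submodule.map_top,
      Submodule.range_subtype]
  have hE : (LinearMap.ker (dualToExtOne B W h₀)).map (dualMap B π₁) =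
      LinearMap.range (dualMap (W := W) B d) := by
    rw [ker_dualToExtOne, ← LinearMap.range_comp]; rfl
  have e₀ := dualPiEquiv A B W a
  have e₁ := dualPiEquiv A B W b
  refine ⟨{
    K := LinearMap.ker π₀
    finite := inferInstance
    rank := b
    π := π₁
    surjective_π := hπ₁
    ψ := dualToExtOne B W h₀
    surjective_ψ := dualToExtOne_surjective h₀
    shift := ?_
    extEquiv := ?_
    detects := ?_ }⟩
  · rintro i m hi rfl
    obtain ⟨i, rfl⟩ := Nat.exists_eq_add_of_le' hi
    exact ⟨(ExtMod.shiftEquiv B W h₀ (i + 1)).symm⟩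
  · rw [hE]
    exact nonempty_extOne_transpose_equiv hW π₀ hπ₀ d hd
  · intro hL
    rw [hE]
    have hinj : Function.Injective (dualMap (W := W) B d) := by
      rw [← LinearMap.ker_eq_bot, LinearMap.ker_eq_bot']
      intro φ hφ
      obtain ⟨ψ, rfl⟩ := (mem_range_dualMap (B := B) hπ₀ hd φ).mpr hφ
      rw [hL.hom_eq_zero one_pos ψ, map_zero]
    exact (detects_zero e₀).succ (IsShortExact.mkQ_range _ hinj) e₁

theorem TransposeStage.nonempty_succ {j : ℕ} (hj : 1 ≤ j) (s : TransposeStage A B W L j)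
    (hL : Subsingleton (ExtMod A W L j)) : Nonempty (TransposeStage A B W L (j + 1)) := by
  have := s.finite
  obtain ⟨c, π', hπ'⟩ := Module.Finite.exists_fin' A (LinearMap.ker s.π)
  have h := IsShortExact.subtype_ker s.π s.surjective_π
  obtain ⟨e⟩ := s.shift 1 (j + 1) le_rfl (add_comm 1 j)
  let d := (LinearMap.ker s.π).subtype ∘ₗ π'
  have hd : LinearMap.range d = LinearMap.ker s.π := by
    rw [LinearMap.range_comp, LinearMap.range_eq_top.mpr hπ', Submodule.map_top,
      Submodule.range_subtype]
  have hker : (LinearMap.ker s.ψ).map (dualMap B s.π) = LinearMap.ker (dualMap (W := W) B d) := by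
    have : LinearMap.ker s.ψ = ⊤ := by
      rw [LinearMap.ker_eq_top]
      ext φ
      exact Subsingleton.elim _ _
    rw [this, Submodule.map_top]
    ext φ
    exact mem_range_dualMap s.surjective_π hd φ
  let ψ := e.symm.toLinearMap ∘ₗ dualToExtOne B W h
  have hrange : (LinearMap.ker ψ).map (dualMap B π') = LinearMap.range (dualMap (W := W) B d) := by
    rw [LinearEquiv.ker_comp, ker_dualToExtOne, ← LinearMap.range_comp]; rfl
  have hX := IsShortExact.liftQ_mkQ _ hker hrange
  have := hW.projective_dual c
  refine ⟨{
    K := LinearMap.ker s.π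
    finite := inferInstance
    rank := c
    π := π'
    surjective_π := hπ'
    ψ := ψ
    surjective_ψ := e.symm.surjective.comp (dualToExtOne_surjective h)
    shift := ?_
    extEquiv := ?_
    detects := ?_ }⟩
  · rintro i m hi rfl
    obtain ⟨e'⟩ := s.shift (i + 1) (i + (j + 1)) (by omega) (by omega)
    obtain ⟨i, rfl⟩ := Nat.exists_eq_add_of_le' hi
    exact ⟨e' ≪≫ₗ (ExtMod.shiftEquiv B W h (i + 1)).symm⟩
  · obtain ⟨e'⟩ := s.extEquiv
    obtain ⟨j, rfl⟩ := Nat.exists_eq_add_of_le' hj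
    exact ⟨(ExtMod.shiftEquiv A W hX (j + 1)).symm ≪≫ₗ e'⟩
  · intro h1
    exact (s.detects h1).succ hX (dualPiEquiv A B W c)

/-- A finitely generated module `L` with `Ext^i(L, W) = 0` for `0 < i < j` has a transposed module
`X` over the other ring: the group `Ext^j(L, W)` embeds into `X`, and `Ext^j(X, W)` recovers the
torsion submodule of `L`. -/
theorem exists_transpose [Module.Finite A L] {j : ℕ} (hj : 1 ≤ j)
    (hL : ∀ i, 1 ≤ i → i < j → Subsingleton (ExtMod A W L i)) :
    ∃ (X : Type u) (_ : AddCommGroup X) (_ : Module B X), Module.Finite B X ∧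
      (∃ ι : ExtMod A W L j →ₗ[B] X, Function.Injective ι) ∧
      Nonempty (ExtMod B W X j ≃ₗ[A] torsionSubmodule A W L) ∧
      (GradeGE A W L 1 → Detects B W X j) := by
  have hs : Nonempty (TransposeStage A B W L j) := by
    induction j, hj using Nat.le_induction with
    | base => exact TransposeStage.nonempty_one hW
    | succ j hj ih =>
      obtain ⟨s⟩ := ih fun i h1 h2 => hL i h1 (by omega)
      exact s.nonempty_succ hW hj (hL j hj (by omega))
  obtain ⟨s⟩ := hs
  have := hW.finite_dual s.rank
  refine ⟨_, inferInstance, inferInstance, inferInstance, ?_, s.extEquiv, s.detects⟩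
  have hle : LinearMap.ker s.ψ ≤ LinearMap.ker
      (((LinearMap.ker s.ψ).map (dualMap B s.π)).mkQ ∘ₗ dualMap B s.π) := fun φ hφ => by
    rw [LinearMap.mem_ker, LinearMap.comp_apply, Submodule.mkQ_apply,
      Submodule.Quotient.mk_eq_zero]
    exact ⟨φ, hφ, rfl⟩
  obtain ⟨ι, hι⟩ := LinearMap.exists_comp_eq_of_surjective s.ψ s.surjective_ψ _ hle
  refine ⟨ι, ?_⟩
  rw [← LinearMap.ker_eq_bot, LinearMap.ker_eq_bot']
  intro x hx
  obtain ⟨φ, rfl⟩ := s.surjective_ψ x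
  have h0 : (((LinearMap.ker s.ψ).map (dualMap B s.π)).mkQ ∘ₗ dualMap B s.π) φ = 0 := by
    rw [← hι]; exact hx
  rw [LinearMap.comp_apply, Submodule.mkQ_apply, Submodule.Quotient.mk_eq_zero] at h0
  obtain ⟨φ', hφ', h1⟩ := h0
  rw [← dualMap_injective s.surjective_π h1]
  exact hφ'

/-- A finitely generated module `L` of grade at least `n` has a transposed module `X` over the
other ring, into which `Ext^n(L, W)` embeds and such that the image of
`Ext^n(X, W) → Ext^n(Ext^n(L, W), W)` is a quotient of `L`. -/
theorem exists_transpose_of_gradeGE [Module.Finite A L] {n : ℕ} (hL : GradeGE A W L n) :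
    ∃ (X : Type u) (_ : AddCommGroup X) (_ : Module B X), Module.Finite B X ∧ Detects B W X n ∧
      ∃ ι : ExtMod A W L n →ₗ[B] X, Function.Injective ι ∧
        ∃ g : L →ₗ[A] ExtMod B W (ExtMod A W L n) n,
          LinearMap.range g = LinearMap.range (ExtMod.precomp A W ι n) := by
  obtain rfl | hn := Nat.eq_zero_or_pos n
  · obtain ⟨a, π, hπ⟩ := Module.Finite.exists_fin' A L
    let e := ExtMod.homEquiv A B W L
    let ι : ExtMod A W L 0 →ₗ[B] ((Fin a → A) →ₗ[A] W) := dualMap B π ∘ₗ e.symm.toLinearMap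
    let g : L →ₗ[A] ExtMod B W (ExtMod A W L 0) 0 :=
      (ExtMod.homEquiv B A W _).toLinearMap ∘ₗ dualMap A e.symm.toLinearMap ∘ₗ evalHom A B W L
    refine ⟨_, inferInstance, inferInstance, hW.finite_dual a, detects_zero (dualPiEquiv A B W a),
      ι, (dualMap_injective hπ).comp e.symm.injective, g, ?_⟩
    have hg (p : Fin a → A) : g (π p) = ExtMod.precomp A W ι 0
        (ExtMod.homEquiv B A W _ (evalHom A B W _ p)) := by
      rw [ExtMod.precomp_homEquiv]; rfl
    ext y
    constructor
    · rintro ⟨x, rfl⟩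
      obtain ⟨p, rfl⟩ := hπ x
      exact ⟨_, (hg p).symm⟩
    · rintro ⟨x, rfl⟩
      obtain ⟨ξ, rfl⟩ := (ExtMod.homEquiv B A W _).surjective x
      obtain ⟨p, rfl⟩ := (hW.evalHom_bijective a).2 ξ
      exact ⟨π p, hg p⟩
  · obtain ⟨X, _, _, hX, ⟨ι, hι⟩, ⟨e⟩, hdet⟩ := exists_transpose hW hn fun i _ hi => hL i hi
    refine ⟨X, _, _, hX, hdet (hL.mono hn), ι, hι, ?_⟩
    have htop : torsionSubmodule A W L = ⊤ := by
      rw [eq_top_iff]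
      rintro x -
      rw [mem_torsionSubmodule]
      intro f
      rw [hL.hom_eq_zero hn f, LinearMap.zero_apply]
    let e' : ExtMod B W X n ≃ₗ[A] L := e ≪≫ₗ LinearEquiv.ofEq _ _ htop ≪≫ₗ Submodule.topEquiv
    refine ⟨ExtMod.precomp A W ι n ∘ₗ e'.symm.toLinearMap, ?_⟩
    exact LinearEquiv.range_comp ..

end Stage

/-! ### The socle of `Ext^n` of a simple module -/

section Socle

variable {R : Type*} [CommRing R] {A B W : Type u} [Ring A] [Ring B] [Algebra R A] [Algebra R B]
  [AddCommGroup W] [Module A W] [Module B W] [SMulCommClass B A W] [SMulCommClass A B W]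

theorem Submodule.exists_isSimpleModule_of_isArtinian (B E : Type*) [Ring B] [AddCommGroup E]
    [Module B E] [IsArtinian B E] [Nontrivial E] : ∃ S : Submodule B E, IsSimpleModule B S := by
  obtain ⟨S, hS⟩ := IsAtomic.exists_atom (Submodule B E)
  exact ⟨S, isSimpleModule_iff_isAtom.mpr hS⟩

theorem finite_extMod [IsNoetherianRing A] [IsNoetherianRing B] (hW : IsDualizing A B W)
    (L : Type u) [AddCommGroup L] [Module A L] [Module.Finite A L] {j : ℕ} (hj : 1 ≤ j)
    (hL : ∀ i, 1 ≤ i → i < j → Subsingleton (ExtMod A W L i)) :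
    Module.Finite B (ExtMod A W L j) := by
  obtain ⟨X, _, _, hX, ⟨ι, hι⟩, -⟩ := exists_transpose hW hj hL
  exact Module.Finite.of_injective ι hι

/-- A simple submodule of `Ext^n(L, W)`, where `L` is simple of grade `n`, has a nonzero `Ext^n`,
into which `L` embeds. -/
theorem exists_injective_extMod_of_simple [IsNoetherianRing A] (hW : IsDualizing A B W) {n : ℕ}
    (h₁ : ExtStrongGradeCondition B A W n n) {L : Type u} [AddCommGroup L] [Module A L]
    [IsSimpleModule A L] (hL : GradeGE A W L n) (S : Submodule B (ExtMod A W L n))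
    [IsSimpleModule B S] : GradeGE B W S n ∧
      ∃ u : L →ₗ[A] ExtMod B W S n, Function.Injective u := by
  have hS : GradeGE B W S n := le_strongGrade_iff.mp (h₁ L) S
  refine ⟨hS, ?_⟩
  obtain ⟨X, _, _, -, hdet, ι, hι, g, hg⟩ := exists_transpose_of_gradeGE hW hL
  have hne : (Abelian.Ext.mk₀ (ModuleCat.ofHom (ι ∘ₗ S.subtype)) : ExtMod B X S 0) ≠ 0 := by
    intro h0
    have h1 : ModuleCat.ofHom (ι ∘ₗ S.subtype) = 0 := (Abelian.Ext.mk₀_eq_zero_iff _).mp h0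
    have := IsSimpleModule.nontrivial B S
    obtain ⟨s, hs⟩ := exists_ne (0 : S)
    have h2 : ι s = 0 := congrArg (fun f => f.hom s) h1
    exact hs (Subtype.ext (hι (h2.trans (map_zero ι).symm)))
  obtain ⟨y, hy⟩ := hdet S 0 n (zero_add n) _ hne hS
  have hy' : ExtMod.precomp A W (ι ∘ₗ S.subtype) n y ≠ 0 := hy
  rw [ExtMod.precomp_comp, LinearMap.comp_apply] at hy'
  obtain ⟨x, hx⟩ : ExtMod.precomp A W ι n y ∈ LinearMap.range g := hg ▸ ⟨y, rfl⟩
  refine ⟨ExtMod.precomp A W S.subtype n ∘ₗ g, (LinearMap.injective_or_eq_zero _).resolve_right ?_⟩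
  intro h0
  rw [← hx] at hy'
  exact hy' (DFunLike.congr_fun h0 x)

theorem gradeGE_of_inf_eq_bot {n : ℕ} {E : Type u} [AddCommGroup E] [Module B E]
    {S I : Submodule B E} (h : S ⊓ I = ⊥) (hI : StrongGradeGE B W (E ⧸ I) n) :
    GradeGE B W S n := by
  refine (hI.of_injective (I.mkQ ∘ₗ S.subtype) ?_).gradeGE
  rw [← LinearMap.ker_eq_bot, LinearMap.ker_eq_bot']
  intro s hs
  rw [LinearMap.comp_apply, Submodule.mkQ_apply, Submodule.Quotient.mk_eq_zero] at hs
  have : (s : E) ∈ S ⊓ I := ⟨s.2, hs⟩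
  rw [h, Submodule.mem_bot] at this
  exact Subtype.ext this

/-- The socle of `Ext^n(L, W)`, where `L` is simple of grade `n`, is simple of grade `n`, the
quotient by it has strong grade greater than `n`, and `L` embeds into its `Ext^n`. -/
theorem isSimpleModule_socExt [IsNoetherianRing A] [IsNoetherianRing B]
    [Module.Finite R A] [Module.Finite R B]
    (hR : ∀ (r : R) (w : W), algebraMap R A r • w = algebraMap R B r • w)
    (hW : IsDualizing A B W) {n : ℕ} (h₁ : ExtStrongGradeCondition B A W n n)
    (h₂ : ExtStrongGradeCondition B A W (n + 1) (n + 1))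
    {L : Type u} [AddCommGroup L] [Module A L] (hL : IsSimpleOfGrade A W L n) :
    IsSimpleOfGrade B W (socExt A B W L n) n ∧
      StrongGradeGE B W (ExtMod A W L n ⧸ socExt A B W L n) (n + 1) ∧
      ∃ u : L →ₗ[A] ExtMod B W (socExt A B W L n) n, Function.Injective u := by
  obtain ⟨hs, hg⟩ := hL
  obtain ⟨hL, hE⟩ := moduleGrade_eq_iff.mp hg
  have hLne := IsSimpleModule.nontrivial A L
  have : Module.Finite B (ExtMod A W L n) := by
    obtain ⟨X, _, _, hX, -, ι, hι, -⟩ := exists_transpose_of_gradeGE hW hL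
    exact Module.Finite.of_injective ι hι
  have : IsArtinian B (ExtMod A W L n) := ExtMod.isArtinian_of_isSimpleModule hR L n
  have hsimple (S : Submodule B (ExtMod A W L n)) [IsSimpleModule B S] :
      Nontrivial (ExtMod B W S n) :=
    have ⟨_, _, hu⟩ := exists_injective_extMod_of_simple hW h₁ hL S
    hu.nontrivial
  have hnot (S : Submodule B (ExtMod A W L n)) [IsSimpleModule B S] :
      ¬ GradeGE B W S (n + 1) := fun h =>
    not_subsingleton_iff_nontrivial.mpr (hsimple S) (h n (Nat.lt_succ_self n))
  obtain ⟨S, hS⟩ := Submodule.exists_isSimpleModule_of_isArtinian B (ExtMod A W L n)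
  obtain ⟨hSn, u, hu⟩ := exists_injective_extMod_of_simple hW h₁ hL S
  obtain ⟨X, _, _, hX, -, ι, hι, g, hgr⟩ := exists_transpose_of_gradeGE hW.symm hSn
  have hj := IsShortExact.mkQ_range (ι ∘ₗ u) (hι.comp hu)
  let δ := ExtMod.connecting B W hj n
  let v : S →ₗ[B] ExtMod A W L n := ExtMod.precomp B W u n ∘ₗ g
  have hI : LinearMap.ker δ = LinearMap.range v := by
    rw [(ExtMod.exact_precomp_connecting B W hj n).linearMap_ker_eq, ExtMod.precomp_comp,
      LinearMap.range_comp, ← hgr, ← LinearMap.range_comp]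
  let I := LinearMap.range v
  have hstrong : StrongGradeGE B W (ExtMod A W (X ⧸ LinearMap.range (ι ∘ₗ u)) (n + 1)) (n + 1) :=
    le_strongGrade_iff.mp (h₂ _)
  have hquot : StrongGradeGE B W (ExtMod A W L n ⧸ I) (n + 1) :=
    hstrong.of_injective (I.liftQ δ hI.ge) (by
      rw [← LinearMap.ker_eq_bot, Submodule.ker_liftQ_eq_bot _ _ _ hI.le])
  have hv : Function.Injective v := by
    refine (LinearMap.injective_or_eq_zero v).resolve_right fun h0 => ?_
    refine hnot S (gradeGE_of_inf_eq_bot ?_ hquot)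
    rw [show I = ⊥ by rw [show I = LinearMap.range v from rfl, h0, LinearMap.range_zero],
      inf_bot_eq]
  have hIs : IsSimpleModule B I := IsSimpleModule.congr (LinearEquiv.ofInjective v hv).symm
  have huniq (S' : Submodule B (ExtMod A W L n)) (hS' : IsSimpleModule B S') : S' = I := by
    by_contra hne
    have hd := (isSimpleModule_iff_isAtom.mp hS').disjoint_of_ne
      (isSimpleModule_iff_isAtom.mp hIs) hne
    exact hnot S' (gradeGE_of_inf_eq_bot hd.eq_bot hquot)
  have hsoc : socExt A B W L n = I := by
    have : {S : Submodule B (ExtMod A W L n) | IsSimpleModule B S} = {I} :=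
      Set.ext fun S' => ⟨huniq S', fun h => by rw [h]; exact hIs⟩
    rw [socExt, socle, this, sSup_singleton]
  rw [hsoc]
  have ⟨hIn, hIu⟩ := exists_injective_extMod_of_simple hW h₁ hL I
  exact ⟨⟨hIs, moduleGrade_eq_iff.mpr ⟨hIn, hsimple I⟩⟩, hquot, hIu⟩

/-- The double application of `soc Ext^n(-, W)` to a simple module of grade `n` gives the module
back. -/
theorem nonempty_socExt_socExt_equiv [IsNoetherianRing A] [IsNoetherianRing B]
    [Module.Finite R A] [Module.Finite R B]
    (hR : ∀ (r : R) (w : W), algebraMap R A r • w = algebraMap R B r • w)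
    (hW : IsDualizing A B W) {n : ℕ} (h₁ : ExtStrongGradeCondition B A W n n)
    (h₂ : ExtStrongGradeCondition B A W (n + 1) (n + 1))
    (h₁' : ExtStrongGradeCondition A B W n n)
    (h₂' : ExtStrongGradeCondition A B W (n + 1) (n + 1))
    {L : Type u} [AddCommGroup L] [Module A L] (hL : IsSimpleOfGrade A W L n) :
    Nonempty (socExt B A W (socExt A B W L n) n ≃ₗ[A] L) := by
  obtain ⟨hI, -, u, hu⟩ := isSimpleModule_socExt hR hW h₁ h₂ hL
  obtain ⟨⟨hJ, -⟩, -⟩ := isSimpleModule_socExt (fun r w => (hR r w).symm) hW.symm h₁' h₂' hI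
  have := hL.1
  have hr : IsSimpleModule A (LinearMap.range u) :=
    IsSimpleModule.congr (LinearEquiv.ofInjective u hu).symm
  have hle : LinearMap.range u ≤ socExt B A W (socExt A B W L n) n := le_sSup hr
  have heq : LinearMap.range u = socExt B A W (socExt A B W L n) n :=
    ((isSimpleModule_iff_isAtom.mp hJ).le_iff_eq (isSimpleModule_iff_isAtom.mp hr).1).mp hle
  exact ⟨(LinearEquiv.ofEq _ _ heq.symm) ≪≫ₗ (LinearEquiv.ofInjective u hu).symm⟩

/-- Isomorphic modules have isomorphic socles. -/
theorem nonempty_socle_equiv {M N : Type u} [AddCommGroup M] [Module A M] [AddCommGroup N]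
    [Module A N] (e : M ≃ₗ[A] N) : Nonempty (socle A M ≃ₗ[A] socle A N) := by
  have hle {M N : Type u} [AddCommGroup M] [Module A M] [AddCommGroup N] [Module A N]
      (e : M ≃ₗ[A] N) : (socle A M).map (e : M →ₗ[A] N) ≤ socle A N := by
    rw [socle, Submodule.map_le_iff_le_comap]
    refine sSup_le fun S hS => Submodule.map_le_iff_le_comap.mp (le_sSup ?_)
    have : IsSimpleModule A S := hS
    exact IsSimpleModule.congr (e.submoduleMap S).symm
  have heq : (socle A M).map (e : M →ₗ[A] N) = socle A N := by
    refine le_antisymm (hle e) fun x hx => ?_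
    exact ⟨e.symm x, hle e.symm ⟨x, hx, rfl⟩, e.apply_symm_apply x⟩
  exact ⟨e.submoduleMap (socle A M) ≪≫ₗ LinearEquiv.ofEq _ _ heq⟩

end Socle

/-! ### Finite global dimension -/

section GlobalDimension

variable {R : Type*} [CommRing R] {A B W : Type u} [Ring A] [Ring B] [Algebra R A] [Algebra R B]
  [AddCommGroup W] [Module A W] [Module B W] [SMulCommClass B A W] [SMulCommClass A B W]

variable (A) in
/-- The groups `Ext^i_A` vanish for `i > n`. -/
def ExtVanishesAbove (n : ℕ) : Prop :=
  ∀ (M Y : Type u) [AddCommGroup M] [Module A M] [AddCommGroup Y] [Module A Y] (i : ℕ),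
    n < i → Subsingleton (ExtMod A Y M i)

theorem extVanishesAbove_of_globalDimension_le {n : ℕ} (h : globalDimension A ≤ n) :
    ExtVanishesAbove A n := by
  intro M Y _ _ _ _ i hi
  have h1 : projectiveDimension (ModuleCat.of A M) ≤ n := (le_iSup _ _).trans h
  have h2 : HasProjectiveDimensionLE (ModuleCat.of A M) n :=
    (projectiveDimension_le_iff _ _).mp h1
  exact HasProjectiveDimensionLT.subsingleton (ModuleCat.of A M) (n + 1) i hi (ModuleCat.of A Y)

/-- In finite global dimension, the vanishing of `Ext^i(U, W)` for all `i ≥ i₀` implies that of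
`Ext^i(U, Y)` for all finitely generated `Y`: this is a descending induction on `i`. -/
theorem ExtVanishesAbove.subsingleton_of_finite [IsNoetherianRing A] (hW : IsDualizing A B W)
    {n : ℕ} (hn : ExtVanishesAbove A n) {U : Type u} [AddCommGroup U] [Module A U] {i₀ : ℕ}
    (hU : ∀ i, i₀ ≤ i → Subsingleton (ExtMod A W U i)) (Y : Type u) [AddCommGroup Y] [Module A Y]
    [Module.Finite A Y] (i : ℕ) (hi : i₀ ≤ i) : Subsingleton (ExtMod A Y U i) := by
  suffices h : ∀ (d : ℕ) (Y : Type u) [AddCommGroup Y] [Module A Y] [Module.Finite A Y] (i : ℕ),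
      i₀ ≤ i → n < i + d → Subsingleton (ExtMod A Y U i) from h (n + 1) Y i hi (by omega)
  intro d
  induction d with
  | zero => exact fun Y _ _ _ i _ h => hn U Y i h
  | succ d ih =>
    intro Y _ _ _ i hi h
    obtain ⟨k, π, hπ⟩ := Module.Finite.exists_fin' A Y
    obtain ⟨e⟩ := hW.nonempty_equiv
    have := hU i hi
    have := ExtMod.subsingleton_pi (A := A) W U i k
    have := ExtMod.subsingleton_congr (L := U) (LinearEquiv.piCongrRight fun _ : Fin k => e) i
    have := ih (LinearMap.ker π) (i + 1) (by omega) (by omega)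
    exact ExtMod.subsingleton_right_covariant (IsShortExact.subtype_ker π hπ) i U

/-- If `Ext_A` vanishes above degree `n` and the `(n+1,n+1)`-condition holds, then
`Ext_B^{n+1}(-, W)` vanishes on finitely generated `B`-modules: a cyclic submodule `U` of it has
`Ext^i_A(U, W) = 0` for all `i`, so the identity of `U` is zero. -/
theorem ExtVanishesAbove.subsingleton_succ [IsNoetherianRing A] (hW : IsDualizing A B W) {n : ℕ}
    (hn : ExtVanishesAbove A n) (h : ExtStrongGradeCondition A B W (n + 1) (n + 1))
    (N : Type u) [AddCommGroup N] [Module B N] [Module.Finite B N] :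
    Subsingleton (ExtMod B W N (n + 1)) := by
  refine subsingleton_of_forall_eq 0 fun x => ?_
  let U := Submodule.span A {x}
  have hU : GradeGE A W U (n + 1) := le_strongGrade_iff.mp (h N) U
  have hU' (i : ℕ) (_ : 0 ≤ i) : Subsingleton (ExtMod A W U i) := by
    by_cases hi : i < n + 1
    · exact hU i hi
    · exact hn U W i (by omega)
  have hUfin : Module.Finite A U := Module.Finite.span_of_finite A (Set.finite_singleton x)
  have h0 := hn.subsingleton_of_finite hW hU' U 0 le_rfl
  have h1 : Abelian.Ext.mk₀ (𝟙 (ModuleCat.of A U)) = Abelian.Ext.mk₀ 0 :=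
    Subsingleton.elim (α := ExtMod A U U 0) _ _
  have h2 := Abelian.Ext.mk₀_bijective _ _ |>.1 h1
  have h3 := congrArg (fun f => f.hom ⟨x, Submodule.mem_span_singleton_self x⟩) h2
  exact congrArg Subtype.val h3

/-- A finitely generated module has a left approximation by a power of `W`. -/
theorem IsDualizing.exists_approximation [IsNoetherianRing B] (hW : IsDualizing A B W)
    (M : Type u) [AddCommGroup M] [Module A M] [Module.Finite A M] :
    ∃ (k : ℕ) (e : M →ₗ[A] (Fin k → W)), LinearMap.ker e = torsionSubmodule A W M ∧
      ∀ φ : M →ₗ[A] W, ∃ ψ : (Fin k → W) →ₗ[A] W, ψ ∘ₗ e = φ := by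
  obtain ⟨a, p, hp⟩ := Module.Finite.exists_fin' A M
  have := hW.finite_dual a
  have : Module.Finite B (M →ₗ[A] W) :=
    Module.Finite.of_injective (dualMap (W := W) B p) (dualMap_injective hp)
  obtain ⟨k, π, hπ⟩ := Module.Finite.exists_fin' B (M →ₗ[A] W)
  let e : M →ₗ[A] (Fin k → W) := LinearMap.pi fun i => π (Pi.single i 1)
  have he (φ : M →ₗ[A] W) : ∃ ψ : (Fin k → W) →ₗ[A] W, ψ ∘ₗ e = φ := by
    obtain ⟨b, rfl⟩ := hπ φ
    refine ⟨∑ i, b i • LinearMap.proj i, ?_⟩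
    have hb : b = ∑ i, b i • Pi.single i (1 : B) := by
      ext j
      simp [Finset.sum_apply, Pi.single_apply]
    conv_rhs => rw [hb, map_sum]
    ext x
    simp [e, LinearMap.sum_apply]
  refine ⟨k, e, ?_, he⟩
  ext x
  rw [LinearMap.mem_ker, mem_torsionSubmodule]
  constructor
  · intro hx φ
    obtain ⟨ψ, rfl⟩ := he φ
    rw [LinearMap.comp_apply, hx, map_zero]
  · intro hx
    ext i
    exact hx _

theorem IsShortExact.exists_factor {K P L X : Type u} [AddCommGroup K] [Module A K]
    [AddCommGroup P] [Module A P] [AddCommGroup L] [Module A L] [AddCommGroup X] [Module A X]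
    {f : K →ₗ[A] P} {g : P →ₗ[A] L} (h : IsShortExact f g) (φ : X →ₗ[A] P) (hφ : g ∘ₗ φ = 0) :
    ∃ ψ : X →ₗ[A] K, f ∘ₗ ψ = φ := by
  have hr (x : X) : φ x ∈ LinearMap.range f := (h.exact _).mp (DFunLike.congr_fun hφ x)
  refine ⟨(LinearEquiv.ofInjective f h.injective).symm.toLinearMap ∘ₗ φ.codRestrict _ hr, ?_⟩
  ext x
  exact congrArg Subtype.val
    ((LinearEquiv.ofInjective f h.injective).apply_symm_apply (φ.codRestrict _ hr x))

/-- In global dimension `n`, a finitely generated nonzero module over the other ring does not have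
grade greater than `n`. -/
theorem ExtVanishesAbove.not_gradeGE [IsNoetherianRing B] (hW : IsDualizing A B W) {n : ℕ}
    (hn : ExtVanishesAbove A n) {S : Type u} [AddCommGroup S] [Module B S] [Module.Finite B S]
    [Nontrivial S] : ¬ GradeGE B W S (n + 1) := by
  intro hS
  obtain ⟨X, _, _, -, -, ⟨e⟩, -⟩ := exists_transpose hW.symm (Nat.succ_le_succ (Nat.zero_le n))
    fun i _ hi => hS i hi
  have := hn X W (n + 1) (Nat.lt_succ_self n)
  obtain ⟨s, hs⟩ := exists_ne (0 : S)
  have hst : s ∈ torsionSubmodule B W S := mem_torsionSubmodule.mpr fun f => by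
    rw [hS.hom_eq_zero (Nat.succ_pos n) f, LinearMap.zero_apply]
  have := e.symm.injective (Subsingleton.elim (e.symm ⟨s, hst⟩) (e.symm 0))
  exact hs (congrArg Subtype.val this)

end GlobalDimension

/-! ### Simple modules of grade zero -/

section GradeZero

variable {R : Type*} [CommRing R] {A B W : Type u} [Ring A] [Ring B] [Algebra R A] [Algebra R B]
  [AddCommGroup W] [Module A W] [Module B W] [SMulCommClass B A W] [SMulCommClass A B W]

/-- A simple module `L` with `L^* ≠ 0` and `Ext^i(L, W) = 0` for `0 < i < N` embeds into a free
module `F` such that `M = F / L` has `Ext^i(M, W) = 0` for `0 < i ≤ N` and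
`Ext^{N+1}(M, W) ≅ Ext^N(L, W)`. -/
theorem exists_cokernel_approximation [IsNoetherianRing A] [IsNoetherianRing B]
    (hW : IsDualizing A B W) {N : ℕ} (hN : 1 ≤ N) {L : Type u} [AddCommGroup L] [Module A L]
    [IsSimpleModule A L] (h₀ : ¬ GradeGE A W L 1)
    (hL : ∀ i, 1 ≤ i → i < N → Subsingleton (ExtMod A W L i)) :
    ∃ (k : ℕ) (e : L →ₗ[A] (Fin k → W)), Function.Injective e ∧
      (∀ i, 1 ≤ i → i < N + 1 →
        Subsingleton (ExtMod A W ((Fin k → W) ⧸ LinearMap.range e) i)) ∧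
      Nonempty (ExtMod A W L N ≃ₗ[B] ExtMod A W ((Fin k → W) ⧸ LinearMap.range e) (N + 1)) := by
  obtain ⟨k, e, hker, he⟩ := hW.exists_approximation L
  have hinj : Function.Injective e := by
    refine (LinearMap.injective_or_eq_zero e).resolve_right fun h => h₀ fun i hi => ?_
    obtain rfl : i = 0 := by omega
    refine subsingleton_of_forall_eq 0 fun x => ?_
    obtain ⟨φ, rfl⟩ := (ExtMod.homEquiv A B W L).surjective x
    obtain ⟨ψ, rfl⟩ := he φ
    rw [h, LinearMap.comp_zero, map_zero]
  have hP := hW.projective_pi k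
  have h := IsShortExact.mkQ_range e hinj
  refine ⟨k, e, hinj, fun i h1 hi => ?_, ?_⟩
  · obtain ⟨i, rfl⟩ := Nat.exists_eq_add_of_le' h1
    obtain rfl | hi0 := Nat.eq_zero_or_pos i
    · refine subsingleton_of_forall_eq 0 fun x => ?_
      obtain ⟨y, rfl⟩ := ExtMod.connecting_surjective B W h 0 x
      refine (ExtMod.exact_precomp_connecting B W h 0 y).mpr ?_
      obtain ⟨φ, rfl⟩ := (ExtMod.homEquiv A B W L).surjective y
      obtain ⟨ψ, rfl⟩ := he φ
      exact ⟨ExtMod.homEquiv A B W _ ψ, ExtMod.precomp_homEquiv ..⟩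
    · have := hL i hi0 (by omega)
      exact ExtMod.subsingleton_right W h i
  · obtain ⟨N, rfl⟩ := Nat.exists_eq_add_of_le' hN
    exact ⟨ExtMod.shiftEquiv B W h (N + 1)⟩

/-- Let `F` be free, `L ⊆ F`, `M = F / L` and let `V` be the torsion submodule of `M`. If `V` has
strong grade at least `N + 1`, if `L` is simple of grade zero with `Ext^i(L, W) = 0` for `0 < i <
N`, and if `Ext_A` vanishes above degree `N + 1`, then `V` cannot be mapped onto the direct product
of two nonzero modules. Indeed the preimage `P` of `V` in `F` has `Ext^1(P, Y) = 0` for all finitely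
generated `Y`, so the projection of the product onto one factor lifts to an endomorphism of `P`.
Every endomorphism of `P` restricts to an endomorphism of `L`; it is determined by this restriction,
so it is zero or bijective. -/
theorem subsingleton_of_surjective_prod [IsNoetherianRing A] [IsNoetherianRing B]
    (hW : IsDualizing A B W) {N : ℕ} (hN : 1 ≤ N) (hgl : ExtVanishesAbove A (N + 1))
    {L : Type u} [AddCommGroup L] [Module A L]
    [IsSimpleModule A L] (h₀ : ¬ GradeGE A W L 1)
    (hL : ∀ i, 1 ≤ i → i < N → Subsingleton (ExtMod A W L i))
    {k : ℕ} (e : L →ₗ[A] (Fin k → W)) (he : Function.Injective e)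
    {V : Submodule A ((Fin k → W) ⧸ LinearMap.range e)}
    (hVt : V = torsionSubmodule A W ((Fin k → W) ⧸ LinearMap.range e))
    (hV : StrongGradeGE A W V (N + 1))
    {T T' : Type u} [AddCommGroup T] [Module A T] [AddCommGroup T'] [Module A T']
    (q : V →ₗ[A] T × T')
    (hq : Function.Surjective q) : Subsingleton T ∨ Subsingleton T' := by
  have := hW.finite_pi k
  have := hW.projective_pi k
  obtain ⟨k', c, hc, -⟩ := hW.exists_approximation ((Fin k → W) ⧸ LinearMap.range e)
  have := hW.projective_pi k'
  rw [← hVt] at hc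
  let r := c ∘ₗ (LinearMap.range e).mkQ
  let P := LinearMap.ker r
  -- the short exact sequences `0 → P → F → C → 0`, `0 → C → G → G / C → 0`, `0 → L → P → V → 0`
  have hPFC : IsShortExact P.subtype r.rangeRestrict :=
    ⟨Subtype.val_injective, by
      rw [LinearMap.exact_iff, LinearMap.ker_rangeRestrict, Submodule.range_subtype],
      r.surjective_rangeRestrict⟩
  have hCG : IsShortExact (LinearMap.range r).subtype (LinearMap.range r).mkQ :=
    ⟨Subtype.val_injective, LinearMap.exact_subtype_mkQ _, Submodule.mkQ_surjective _⟩
  have hrV (x : Fin k → W) : x ∈ P ↔ (LinearMap.range e).mkQ x ∈ V := by rw [← hc]; rfl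
  have heP (x : L) : e x ∈ P := by
    rw [hrV, (LinearMap.exact_map_mkQ_range e).apply_apply_eq_zero]; exact V.zero_mem
  let i : L →ₗ[A] P := e.codRestrict P heP
  let p : P →ₗ[A] V := (LinearMap.range e).mkQ.restrict fun x hx => (hrV x).mp hx
  have hLPV : IsShortExact i p := by
    refine ⟨fun x y h => he (congrArg Subtype.val h), fun x => ⟨fun hx => ?_, ?_⟩, ?_⟩
    · obtain ⟨y, hy⟩ := (LinearMap.exact_map_mkQ_range e x).mp (congrArg Subtype.val hx)
      exact ⟨y, Subtype.ext hy⟩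
    · rintro ⟨y, rfl⟩
      exact Subtype.ext ((LinearMap.exact_map_mkQ_range e).apply_apply_eq_zero y)
    · rintro ⟨v, hv⟩
      obtain ⟨x, rfl⟩ := Submodule.mkQ_surjective _ v
      exact ⟨⟨x, (hrV x).mpr hv⟩, rfl⟩
  have hVg := hV.gradeGE
  -- a linear map from `P` to a torsionless module is determined by its restriction to `L`
  have hkill {m : ℕ} (s : P →ₗ[A] (Fin m → W)) (hs : s ∘ₗ i = 0) : s = 0 := by
    obtain ⟨t, rfl⟩ := LinearMap.exists_comp_eq_of_surjective p hLPV.surjective s (by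
      rw [hLPV.exact.linearMap_ker_eq]
      rintro _ ⟨x, rfl⟩
      exact DFunLike.congr_fun hs x)
    have : t = 0 := by
      ext v j
      exact DFunLike.congr_fun (hVg.hom_eq_zero (Nat.succ_pos N) (LinearMap.proj j ∘ₗ t)) v
    rw [this, LinearMap.zero_comp]
  have hkillP (s : P →ₗ[A] P) (hs : s ∘ₗ i = 0) : s = 0 := by
    have := hkill (P.subtype ∘ₗ s) (by rw [LinearMap.comp_assoc, hs, LinearMap.comp_zero])
    ext1 x
    exact Subtype.ext (DFunLike.congr_fun this x)
  have hLV (f : L →ₗ[A] V) : f = 0 :=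
    (LinearMap.injective_or_eq_zero f).resolve_left fun hf =>
      h₀ ((hV.of_injective f hf).gradeGE.mono (by omega))
  have hExt (j : ℕ) (hj : 1 ≤ j) : Subsingleton (ExtMod A W P j) := by
    by_cases hjN : j < N
    · have := hL j hj hjN
      have := hVg j (by omega)
      exact ExtMod.subsingleton_middle W hLPV j
    · obtain ⟨j, rfl⟩ := Nat.exists_eq_add_of_le' hj
      have := hgl ((Fin k' → W) ⧸ LinearMap.range r) W (j + 1 + 1 + 1) (by omega)
      have := ExtMod.subsingleton_left W hCG (j + 1 + 1)
      exact ExtMod.subsingleton_left W hPFC (j + 1)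
  -- the endomorphism `h` of `P` that lifts the projection of `T × T'` onto `T`
  let Q := q ∘ₗ p
  have hQ : Function.Surjective Q := hq.comp hLPV.surjective
  have := hgl.subsingleton_of_finite hW hExt (LinearMap.ker Q) 1 le_rfl
  obtain ⟨h, hh⟩ := ExtMod.exists_lift (IsShortExact.subtype_ker Q hQ) P
    (LinearMap.inl A T T' ∘ₗ LinearMap.fst A T T' ∘ₗ Q)
  obtain ⟨hL', hhL⟩ := hLPV.exists_factor (h ∘ₗ i) (hLV _)
  rcases LinearMap.bijective_or_eq_zero hL' with hbij | h0
  · right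
    -- the inverse of the restriction of `h` to `L` extends to a right inverse of `h`
    let inv := (LinearEquiv.ofBijective hL' hbij).symm
    have := hVg 1 (by omega)
    have := ExtMod.subsingleton_pi (A := A) W V 1 k
    obtain ⟨g, hg⟩ := ExtMod.exists_extension (Fin k → W) hLPV
      (P.subtype ∘ₗ i ∘ₗ inv.toLinearMap)
    have hrg : r ∘ₗ g = 0 := hkill _ (by
      rw [LinearMap.comp_assoc, hg]
      ext1 x
      exact (i (inv x)).2)
    obtain ⟨g', hg'⟩ := hPFC.exists_factor g (by
      ext1 x
      exact Subtype.ext (DFunLike.congr_fun hrg x))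
    have hgi : g' ∘ₗ i = i ∘ₗ inv.toLinearMap := by
      ext1 x
      apply Subtype.ext
      rw [← hg'] at hg
      exact DFunLike.congr_fun hg x
    have hid : h ∘ₗ g' - LinearMap.id = 0 := hkillP _ (by
      rw [LinearMap.sub_comp, LinearMap.comp_assoc, hgi, ← LinearMap.comp_assoc, ← hhL]
      ext1 x
      have : hL' (inv x) = x := (LinearEquiv.ofBijective hL' hbij).apply_symm_apply x
      simp [this])
    refine subsingleton_of_forall_eq 0 fun t => ?_
    obtain ⟨x, hx⟩ := hQ (0, t)
    have hx' : h (g' x) = x := sub_eq_zero.mp (DFunLike.congr_fun hid x)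
    have := DFunLike.congr_fun hh (g' x)
    rw [LinearMap.comp_apply, hx', hx] at this
    exact congrArg Prod.snd this
  · left
    have hz : h = 0 := hkillP h (by rw [← hhL, h0, LinearMap.comp_zero])
    refine subsingleton_of_forall_eq 0 fun t => ?_
    obtain ⟨x, hx⟩ := hQ (t, 0)
    have := DFunLike.congr_fun hh x
    rw [hz, LinearMap.comp_zero, LinearMap.zero_apply, LinearMap.comp_apply,
      LinearMap.comp_apply, hx] at this
    exact (congrArg Prod.fst this).symm

/-- If `Ext^n_B(-, W)` is right exact and `S`, `S'` are independent submodules of `X`, then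
`Ext^n(X, W)` is mapped onto `Ext^n(S, W) × Ext^n(S', W)`. -/
theorem exists_surjective_extMod_prod {n : ℕ} {S S' X : Type u} [AddCommGroup S] [Module B S]
    [AddCommGroup S'] [Module B S'] [AddCommGroup X] [Module B X] (f : S →ₗ[B] X) (f' : S' →ₗ[B] X)
    (hf : Function.Injective (f.coprod f'))
    [Subsingleton (ExtMod B W (X ⧸ LinearMap.range (f.coprod f')) (n + 1))] :
    ∃ q : ExtMod B W X n →ₗ[A] ExtMod B W S n × ExtMod B W S' n, Function.Surjective q := by
  refine ⟨(ExtMod.precomp A W f n).prod (ExtMod.precomp A W f' n), ?_⟩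
  rintro ⟨t, t'⟩
  obtain ⟨x, hx⟩ := ExtMod.precomp_surjective A W (IsShortExact.mkQ_range _ hf) n
    (ExtMod.precomp A W (LinearMap.fst B S S') n t + ExtMod.precomp A W (LinearMap.snd B S S') n t')
  refine ⟨x, Prod.ext ?_ ?_⟩
  · change ExtMod.precomp A W f n x = t
    conv_lhs => rw [← LinearMap.coprod_inl f f', ExtMod.precomp_comp, LinearMap.comp_apply, hx,
      map_add, ← LinearMap.comp_apply, ← LinearMap.comp_apply, ← ExtMod.precomp_comp,
      ← ExtMod.precomp_comp, LinearMap.fst_comp_inl, LinearMap.snd_comp_inl, ExtMod.precomp_id,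
      ExtMod.precomp_zero]
    simp
  · change ExtMod.precomp A W f' n x = t'
    conv_lhs => rw [← LinearMap.coprod_inr f f', ExtMod.precomp_comp, LinearMap.comp_apply, hx,
      map_add, ← LinearMap.comp_apply, ← LinearMap.comp_apply, ← ExtMod.precomp_comp,
      ← ExtMod.precomp_comp, LinearMap.fst_comp_inr, LinearMap.snd_comp_inr, ExtMod.precomp_id,
      ExtMod.precomp_zero]
    simp

/-- In global dimension `N + 1`, if `L` is simple of grade zero and reduced grade `N`, then the
socle of `Ext^N(L, W)` is simple: two different simple submodules `S`, `S'` would give a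
surjection of the torsion submodule of the cokernel `M` of an approximation of `L` onto
`Ext^{N+1}(S, W) × Ext^{N+1}(S', W)`. -/
theorem isSimpleModule_socExt_of_gradeZero [IsNoetherianRing A] [IsNoetherianRing B]
    [Module.Finite R A] [Module.Finite R B]
    (hR : ∀ (r : R) (w : W), algebraMap R A r • w = algebraMap R B r • w)
    (hW : IsDualizing A B W) {N : ℕ} (hN : 1 ≤ N) (hgl : ExtVanishesAbove A (N + 1))
    (h₁ : ExtStrongGradeCondition B A W (N + 1) (N + 1))
    (h₁' : ExtStrongGradeCondition A B W (N + 1) (N + 1))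
    (h₂' : ExtStrongGradeCondition A B W (N + 2) (N + 2))
    {L : Type u} [AddCommGroup L] [Module A L] [IsSimpleModule A L] (h₀ : ¬ GradeGE A W L 1)
    (hL : ∀ i, 1 ≤ i → i < N → Subsingleton (ExtMod A W L i)) (hE : Nontrivial (ExtMod A W L N)) :
    IsSimpleModule B (socExt A B W L N) ∧
      strongGrade B W (ExtMod A W L N) = (N + 1 : ℕ) := by
  obtain ⟨k, e, he, hM, ⟨σ⟩⟩ := exists_cokernel_approximation hW hN h₀ hL
  have := hW.finite_pi k
  have hstrong : StrongGradeGE B W (ExtMod A W L N) (N + 1) :=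
    StrongGradeGE.of_injective (le_strongGrade_iff.mp (h₁ _)) σ.toLinearMap σ.injective
  have := finite_extMod hW L hN hL
  have := ExtMod.isArtinian_of_isSimpleModule hR L N
  have hExt (S : Submodule B (ExtMod A W L N)) [IsSimpleModule B S] :
      Nontrivial (ExtMod B W S (N + 1)) := by
    have := IsSimpleModule.nontrivial B S
    by_contra hn
    rw [not_nontrivial_iff_subsingleton] at hn
    refine hgl.not_gradeGE hW (S := S) fun i hi => ?_
    obtain hi | rfl := Nat.lt_succ_iff_lt_or_eq.mp hi
    · exact hstrong S i hi
    · exact hn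
  obtain ⟨X, _, _, hX, ⟨ι, hι⟩, ⟨τ⟩, -⟩ := exists_transpose hW (by omega : 1 ≤ N + 1) hM
  have hV := StrongGradeGE.of_injective (le_strongGrade_iff.mp (h₁' X)) τ.symm.toLinearMap
    τ.symm.injective
  have huniq (S S' : Submodule B (ExtMod A W L N)) (hS : IsSimpleModule B S)
      (hS' : IsSimpleModule B S') : S = S' := by
    by_contra hne
    have hd := (isSimpleModule_iff_isAtom.mp hS).disjoint_of_ne
      (isSimpleModule_iff_isAtom.mp hS') hne
    let j : ExtMod A W L N →ₗ[B] X := ι ∘ₗ σ.toLinearMap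
    have hinj : Function.Injective ((j ∘ₗ S.subtype).coprod (j ∘ₗ S'.subtype)) := by
      rw [← LinearMap.comp_coprod]
      refine (hι.comp σ.injective).comp ?_
      rw [← LinearMap.ker_eq_bot, LinearMap.ker_coprod_of_disjoint_range]
      · simp
      · simpa using hd
    have := hgl.subsingleton_succ hW h₂'
      (X ⧸ LinearMap.range ((j ∘ₗ S.subtype).coprod (j ∘ₗ S'.subtype)))
    obtain ⟨q, hq⟩ := exists_surjective_extMod_prod (A := A) (W := W) (n := N + 1) _ _ hinj
    have h1 := hExt S
    have h2 := hExt S'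
    rcases subsingleton_of_surjective_prod hW hN hgl h₀ hL e he rfl hV
      (q ∘ₗ τ.symm.toLinearMap) (hq.comp τ.symm.surjective) with h | h
    · exact not_subsingleton_iff_nontrivial.mpr h1 h
    · exact not_subsingleton_iff_nontrivial.mpr h2 h
  obtain ⟨S, hS⟩ := Submodule.exists_isSimpleModule_of_isArtinian B (ExtMod A W L N)
  constructor
  · have : {S : Submodule B (ExtMod A W L N) | IsSimpleModule B S} = {S} :=
      Set.ext fun S' => ⟨fun h => huniq S' S h hS, fun h => by rw [h]; exact hS⟩
    rw [socExt, socle, this, sSup_singleton]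
    exact hS
  · refine le_antisymm ?_ (le_strongGrade_iff.mpr hstrong)
    exact (iInf_le _ S).trans (moduleGrade_eq_iff.mpr ⟨hstrong S, hExt S⟩).le

end GradeZero

/-! ### Noetherian algebras -/

theorem isDualizing_self (Γ : Type u) [Ring Γ] : IsDualizing Γ Γᵐᵒᵖ Γ := by
  refine ⟨1, ?_, ?_⟩
  · simpa using! Function.bijective_id
  · simpa using MulOpposite.unop_bijective

end

theorem mainTheorem10 {R : Type*} [CommRing R] [IsNoetherianRing R]
    {Γ : Type u} [Ring Γ] [Algebra R Γ] [Module.Finite R Γ] (n : ℕ)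
    (h₁ : LNCondition Γ n n) (h₁op : LNConditionOp Γ n n)
    (h₂ : LNCondition Γ (n + 1) (n + 1)) (h₂op : LNConditionOp Γ (n + 1) (n + 1)) :
    DualityCondition Γ n ∧
    (globalDimension Γ = n → 2 ≤ n →
      ∀ (L : Type u) [AddCommGroup L] [Module Γ L], IsSimpleModule Γ L →
        moduleGrade Γ Γ L = 0 → reducedGrade Γ Γ L = (n - 1 : ℕ) →
          IsSimpleModule Γᵐᵒᵖ (socExt Γ Γᵐᵒᵖ Γ L (n - 1)) ∧
          strongGrade Γᵐᵒᵖ Γ (ExtMod Γ Γ L (n - 1)) = n) := by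
  have hfin : Module.Finite R Γᵐᵒᵖ := Module.Finite.equiv (MulOpposite.opLinearEquiv R)
  have hnoeth : IsNoetherianRing Γ :=
    isNoetherian_of_tower R (isNoetherian_of_isNoetherianRing_of_finite R Γ)
  have hnoeth' : IsNoetherianRing Γᵐᵒᵖ :=
    isNoetherian_of_tower R (isNoetherian_of_isNoetherianRing_of_finite R Γᵐᵒᵖ)
  have hR (r : R) (w : Γ) : algebraMap R Γ r • w = algebraMap R Γᵐᵒᵖ r • w := by
    rw [MulOpposite.algebraMap_apply, MulOpposite.smul_eq_mul_unop, MulOpposite.unop_op,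
      smul_eq_mul, Algebra.commutes]
  have hR' (r : R) (w : Γ) := (hR r w).symm
  have hW := isDualizing_self Γ
  have hinv (L : Type u) [AddCommGroup L] [Module Γ L] (hL : IsSimpleOfGrade Γ Γ L n) :=
    nonempty_socExt_socExt_equiv hR hW h₁op h₂op h₁ h₂ hL
  have hcongr {A B : Type u} [Ring A] [Ring B] [Module A Γ] [Module B Γ] [SMulCommClass B A Γ]
      {L L' : Type u} [AddCommGroup L] [Module A L] [AddCommGroup L'] [Module A L']
      (e : L ≃ₗ[A] L') : Nonempty (socExt A B Γ L n ≃ₗ[B] socExt A B Γ L' n) :=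
    nonempty_socle_equiv (ExtMod.congrEquiv B Γ e.symm n)
  refine ⟨⟨fun L _ _ hL => (isSimpleModule_socExt hR hW h₁op h₂op hL).1,
    fun L L' _ _ _ _ _ _ ⟨e⟩ => hcongr e, fun L L' _ _ _ _ hL hL' ⟨e⟩ => ?_, fun N _ _ hN => ?_,
    fun L _ _ hL => hinv L hL, fun L _ _ hL => ?_⟩, fun hgl hn L _ _ hs h0 hr => ?_⟩
  · obtain ⟨e₁⟩ := hinv L hL
    obtain ⟨e₂⟩ := hinv L' hL'
    obtain ⟨e₃⟩ := hcongr (A := Γᵐᵒᵖ) (B := Γ) e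
    exact ⟨e₁.symm ≪≫ₗ e₃ ≪≫ₗ e₂⟩
  · exact ⟨socExt Γᵐᵒᵖ Γ Γ N n, inferInstance, inferInstance,
      (isSimpleModule_socExt hR' hW.symm h₁ h₂ hN).1,
      nonempty_socExt_socExt_equiv hR' hW.symm h₁ h₂ h₁op h₂op hN⟩
  · refine lt_of_lt_of_le ?_
      (le_strongGrade_iff.mpr (isSimpleModule_socExt hR hW h₁op h₂op hL).2.1)
    exact Nat.cast_lt.mpr (Nat.lt_succ_self n)
  · obtain ⟨N, rfl⟩ := Nat.exists_eq_add_of_le' (by omega : 1 ≤ n)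
    rw [Nat.add_sub_cancel] at hr ⊢
    have h0' := (moduleGrade_eq_iff (n := 0)).mp h0
    refine isSimpleModule_socExt_of_gradeZero hR hW (by omega)
      (extVanishesAbove_of_globalDimension_le hgl.le) h₁op h₁ h₂ ?_ ?_ ?_
    · exact fun h => not_subsingleton_iff_nontrivial.mpr h0'.2 (h 0 one_pos)
    · intro i h1 hi
      by_contra hne
      rw [not_subsingleton_iff_nontrivial] at hne
      have : reducedGrade Γ Γ L ≤ i := iInf_le_of_le i (iInf₂_le h1 hne)
      rw [hr, Nat.cast_le] at this
      omega
    · by_contra hne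
      have : ((N + 1 : ℕ) : ℕ∞) ≤ reducedGrade Γ Γ L := by
        refine le_iInf fun i => le_iInf₂ fun _ hi => ?_
        rw [Nat.cast_le]
        by_contra hlt
        have hle : reducedGrade Γ Γ L ≤ i := iInf_le_of_le i (iInf₂_le ‹_› hi)
        rw [hr, Nat.cast_le] at hle
        obtain rfl : i = N := by omega
        exact hne hi
      rw [hr, Nat.cast_le] at this
      omega
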